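/- Let $k$ be a field, $K$ a finite simplicial complex, $\Delta K$ the poset of subcomplexes of $K$ ordered by inclusion (the empty subcomplex included), $P$ a finite poset, and $F : P \to \Delta K$ a filtration, i.e. a monotone map. Let $\mathrm{Int}\,P$ be the set of intervals $[a,b]$ with $a \le b$ in $P$, with the product order $[a,b] \le [c,d] \iff a \le c$ and $b \le d$. For a function $m : \mathrm{Int}\,P \to \mathbb{Z}$, its Möbius inversion $\partial m : \mathrm{Int}\,P \to \mathbb{Z}$ is the unique function with $m(I) = \sum_{J \le I} \partial m(J)$ for all $I \in \mathrm{Int}\,P$. Two functions $m, n : \mathrm{Int}\,P \to \mathbb{Z}$ are equivalent, $m \sim n$, if $m[a,b] = n[a,b]$ for all $a < b$. Fix an integer $d \ge 0$. Let $Z_dF(a)$ and $B_dF(a)$ be the spaces of $d$-cycles and $d$-boundaries of the (unreduced) simplicial chain complex of $F(a)$ with coefficients in $k$, and define $$\mathsf{BD}_d F\,[a,b] = \dim\big(Z_dF(a) \cap B_dF(b)\big).$$ Let $H_d|F| : P \to \mathsf{Vec}$ be the persistence module $a \mapsto H_d(|F(a)|; k)$ given by the singular homology of the underlying spaces and the maps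 induced by inclusions. For $a \in P$ let $k^{\uparrow a}$ be the $P$-module with value $k$ at every $b \ge a$ and $0$ elsewhere, with identity maps between its nonzero values. A $P$-module is free if it is isomorphic to a direct sum of modules of the form $k^{\uparrow a}$. A free presentation of a $P$-module $M$ is a natural transformation $\varphi : E \Rightarrow M$, surjective at every $b \in P$, from a free, pointwise finite-dimensional $P$-module $E$. For such $\varphi$ define $$\mathsf{BD}\,\varphi\,[a,b] = \dim\big(E(a) \cap \ker \varphi_b\big) = \dim\{x \in E(a) : \varphi_b(E(a \le b)(x)) = 0\}.$$ Then, for every free presentation $\varphi$ of $H_d|F|$, $$\partial\, \mathsf{BD}_d F \sim \partial\, \mathsf{BD}\,\varphi .$$ -/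

import Mathlib

open CategoryTheory
open scoped DirectSum

universe u v

noncomputable section

namespace PersistenceDiagram

/-! ### Intervals and Möbius inversion -/

/-- The poset of intervals `[a, b]`, `a ≤ b`, of a poset, with the product order:
`[a, b] ≤ [c, d]` iff `a ≤ c` and `b ≤ d` (not the containment order). -/
abbrev Intervals (P : Type*) [PartialOrder P] : Type _ := {I : P × P // I.1 ≤ I.2}

/-- Every integral function on a finite poset has exactly one Möbius inversion. -/
theorem existsUnique_moebius {Q : Type*} [PartialOrder Q] [Finite Q] (m : Q → ℤ) :
    ∃! n : Q → ℤ, ∀ b, m b = ∑ᶠ a ∈ Set.Iic b, n a := by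
  have key : ∀ (n : Q → ℤ) (b : Q),
      ∑ᶠ a ∈ Set.Iic b, n a = n b + ∑ᶠ a ∈ Set.Iio b, n a := by
    intro n b
    rw [← Set.Iio_insert, finsum_mem_insert n (by simp) (Set.toFinite _)]
  have wf : WellFounded ((· < ·) : Q → Q → Prop) := wellFounded_lt
  let n : Q → ℤ := wf.fix fun b ih => m b - ∑ᶠ a : Set.Iio b, ih a.1 a.2
  have hn : ∀ b, n b = m b - ∑ᶠ a ∈ Set.Iio b, n a := by
    intro b
    rw [← finsum_set_coe_eq_finsum_mem]
    exact wf.fix_eq _ b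
  refine ⟨n, fun b => ?_, fun n' hn' => ?_⟩
  · rw [key, hn b]; ring
  · funext b
    induction b using wf.induction with
    | _ b ih =>
      have h1 := hn' b
      rw [key] at h1
      have h2 : ∑ᶠ a ∈ Set.Iio b, n' a = ∑ᶠ a ∈ Set.Iio b, n a :=
        finsum_mem_congr rfl fun a ha => ih a ha
      rw [hn b, ← h2]
      linarith

/-- The Möbius inversion `∂m` of `m : Q → ℤ`: the unique function with
`m b = ∑_{a ≤ b} ∂m a` for all `b`. -/
def moebius {Q : Type*} [PartialOrder Q] [Finite Q] (m : Q → ℤ) : Q → ℤ :=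
  (existsUnique_moebius m).choose

/-- Two functions on intervals are equivalent if they agree off the diagonal,
i.e. on all `[a, b]` with `a < b`. -/
def Equivalent {P : Type*} [PartialOrder P] (m n : Intervals P → ℤ) : Prop :=
  ∀ I : Intervals P, I.1.1 < I.1.2 → m I = n I

/-! ### Simplicial chains -/

section Chains

variable (k : Type u) [Field k] {V : Type*} [LinearOrder V]

/-- The simplicial boundary map, defined on the span of all finite vertex sets. A simplex
`{v₀ < ⋯ < v_d}` with `d ≥ 1` is sent to `∑ᵢ (-1)ⁱ {v₀, …, v̂ᵢ, …, v_d}`; vertices (and the empty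
set, which is never a simplex) are sent to `0`. -/
def boundaryMap : (Finset V →₀ k) →ₗ[k] (Finset V →₀ k) :=
  Finsupp.linearCombination k fun s : Finset V =>
    if 2 ≤ s.card then
      ∑ x ∈ s, Finsupp.single (s.erase x) ((-1 : k) ^ (s.filter (· < x)).card)
    else 0

/-- The space `C_d(A)` of simplicial `d`-chains of a simplicial complex `A`. -/
def chains (A : PreAbstractSimplicialComplex V) (d : ℕ) : Submodule k (Finset V →₀ k) :=
  Finsupp.supported k k {s | s ∈ A ∧ s.card = d + 1}

/-- The cycle space `Z_d(A)`. -/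
def cycles (A : PreAbstractSimplicialComplex V) (d : ℕ) : Submodule k (Finset V →₀ k) :=
  chains k A d ⊓ LinearMap.ker (boundaryMap k)

/-- The boundary space `B_d(A)`. -/
def boundaries (A : PreAbstractSimplicialComplex V) (d : ℕ) : Submodule k (Finset V →₀ k) :=
  (chains k A (d + 1)).map (boundaryMap k)

end Chains

/-! ### Filtrations -/

/-- A filtration of `K` indexed by `P`: a monotone map from `P` to the poset of subcomplexes
of `K`, ordered by inclusion. -/
abbrev Filtration (P : Type*) [PartialOrder P] {V : Type*}
    (K : PreAbstractSimplicialComplex V) : Type _ :=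
  P →o Set.Iic K

/-- The `d`-th birth-death function of a filtration:
`[a, b] ↦ dim (Z_d F(a) ∩ B_d F(b))`. -/
def filtrationBD (k : Type u) [Field k] {P : Type*} [PartialOrder P]
    {V : Type*} [LinearOrder V] {K : PreAbstractSimplicialComplex V}
    (F : Filtration P K) (d : ℕ) : Intervals P → ℤ := fun I =>
  (Module.finrank k
    (cycles k (F I.1.1).1 d ⊓ boundaries k (F I.1.2).1 d : Submodule k (Finset V →₀ k)) : ℤ)

/-! ### Underlying spaces and the persistent homology module -/

/-- The underlying space `|A|` of a finite simplicial complex: the points of the standard simplex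
on the vertex set whose nonzero barycentric coordinates all belong to one common simplex
of `A`. -/
def realizationSet {V : Type u} [Fintype V] (A : PreAbstractSimplicialComplex V) : Set (V → ℝ) :=
  {x | x ∈ stdSimplex ℝ V ∧ ∃ s ∈ A, Function.support x ⊆ (s : Set V)}

theorem realizationSet_mono {V : Type u} [Fintype V] {A B : PreAbstractSimplicialComplex V}
    (h : A ≤ B) : realizationSet A ⊆ realizationSet B :=
  fun _ ⟨hx, s, hs, hsub⟩ => ⟨hx, s, h hs, hsub⟩

/-- The functor `A ↦ |A|` from simplicial complexes on the vertex set `V`, ordered by inclusion,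
to topological spaces (with the subspace topology from `V → ℝ`). -/
def realization (V : Type u) [Fintype V] : PreAbstractSimplicialComplex V ⥤ TopCat.{u} where
  obj A := TopCat.of (realizationSet A)
  map f := TopCat.ofHom
    ⟨Set.inclusion (realizationSet_mono (leOfHom f)), continuous_inclusion _⟩
  map_id _ := rfl
  map_comp _ _ := rfl

/-- The persistence module `H_d|F|`, obtained by applying singular homology with coefficients in
`k` to the underlying spaces `|F(a)|` and the inclusions between them. -/
def homologyModule (k : Type u) [Field k] {P : Type v} [PartialOrder P]
    {V : Type u} [Fintype V] {K : PreAbstractSimplicialComplex V}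
    (F : Filtration P K) (d : ℕ) : P ⥤ ModuleCat.{u} k :=
  Monotone.functor (f := fun a => (F a).1) (fun _ _ h => F.monotone h) ⋙ realization V ⋙
    (AlgebraicTopology.singularHomologyFunctor (ModuleCat.{u} k) d).obj (ModuleCat.of k k)

/-! ### Free modules and presentations -/

section Modules

variable (k : Type u) [Field k] {P : Type v} [PartialOrder P]

/-- The value `k^{↑a}(b)`: all of `k` if `a ≤ b`, and `0` otherwise. -/
def upSpace (a b : P) : Submodule k k where
  carrier := {x | ¬ a ≤ b → x = 0}
  add_mem' hx hy h := by rw [hx h, hy h, add_zero]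
  zero_mem' _ := rfl
  smul_mem' c x hx h := by rw [hx h, smul_zero]

theorem upSpace_mono (a : P) {b c : P} (h : b ≤ c) : upSpace k a b ≤ upSpace k a c :=
  fun _ hx hc => hx fun hb => hc (hb.trans h)

/-- The direct sum `⨁ᵢ k^{↑(c i)}` as a persistence module. Its structure maps are the direct sums
of the inclusions `k^{↑(c i)}(a) ⊆ k^{↑(c i)}(b)`, which are `1_k` when `c i ≤ a`. -/
def upSum {ι : Type} (c : ι → P) : P ⥤ ModuleCat.{u} k where
  obj a := ModuleCat.of k (⨁ i, upSpace k (c i) a)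
  map f := ModuleCat.ofHom
    (DirectSum.lmap fun i => Submodule.inclusion (upSpace_mono k (c i) (leOfHom f)))
  map_id a := by
    apply ModuleCat.hom_ext
    exact DirectSum.lmap_id
  map_comp f g := by
    apply ModuleCat.hom_ext
    exact DirectSum.lmap_comp
      (fun i => Submodule.inclusion (upSpace_mono k (c i) (leOfHom f)))
      (fun i => Submodule.inclusion (upSpace_mono k (c i) (leOfHom g)))

variable {k}

/-- `φ : E ⟶ M` is a (free) presentation of the persistence module `M` in the category of
finite-dimensional vector spaces: `E` is finite-dimensional at each index, `E` is isomorphic to a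
direct sum of modules of the form `k^{↑a}`, and `φ` is surjective at each index. -/
structure IsPresentation {E M : P ⥤ ModuleCat.{u} k} (φ : E ⟶ M) : Prop where
  finiteDimensional : ∀ a, FiniteDimensional k (E.obj a)
  free : ∃ (ι : Type) (c : ι → P), Nonempty (E ≅ upSum k c)
  surjective : ∀ a, Function.Surjective (φ.app a)

/-- The birth-death function of `φ : E ⟶ M`: `[a, b] ↦ dim (E(a) ∩ ker φ_b)`, where
`E(a) ∩ ker φ_b` is the pullback of `ker φ_b ⊆ E(b)` along `E(a) → E(b)`. -/
def presentationBD {E M : P ⥤ ModuleCat.{u} k} (φ : E ⟶ M) : Intervals P → ℤ := fun I =>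
  (Module.finrank k
    ((LinearMap.ker (φ.app I.1.2).hom).comap (E.map (homOfLE I.2)).hom) : ℤ)

end Modules

end PersistenceDiagram

end

/-! Both birth-death functions are a term depending only on the left endpoint, minus the rank of the
structure map `H_d|F(a)| → H_d|F(b)|`. For a presentation, naturality identifies `φ_b ∘ E(a ≤ b)`
with `M(a ≤ b) ∘ φ_a`, and `φ_a` is onto, so rank-nullity leaves `dim E(a)` minus the rank
(`presentationBD_eq`). For the filtration, `Z_d F(a)` maps onto `H_d|F(a)|`, and a cycle dies at `b`
exactly if it lies in `B_d F(b)`; this leaves `dim Z_d F(a)` minus the same rank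
(`filtrationBD_eq`). The two functions thus differ by `c(a) = dim Z_d F(a) - dim E(a)`. Since `[x,x]
≤ [a,b]` iff `x ≤ a`, the Möbius inversion of `[a,b] ↦ c(a)` is `∂c` placed on the diagonal, where
equivalence does not look (`equivalent_moebius_of_eq_add`).

Most of the work is the natural comparison of simplicial and singular homology
(`cycleClass_surjective`, `cycleClass_eq_zero_iff`, `homologyMap_cycleClass`). Every `|A|` lies in
`V → ℝ`, so its chains form a subspace of one ambient chain space, and enlarging `A` only enlarges
the subspace. Chains are indexed by the number `n` of vertices and complexes are augmented, so that
recursions start at the empty simplex.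

One chain map sends a sorted simplex to its affine singular simplex. In the other direction,
`subdivisionApproximation` subdivides `N` times, replaces each corner by a vertex of maximal
barycentric coordinate, and sorts the resulting tuple. It is a left inverse for every `N`, because a
chain endomorphism carried by simplices and equal to the identity on the empty one is the identity
(`eq_single_of_carried`). For `N` large it maps a given chain of `|A|` to chains of `A`, which gives
the kernel. Surjectivity follows from chain homotopies built by iterated cones: singular simplex to
subdivision, subdivision to approximation, tuple to sorted tuple (`exists_mem_cycles_sub_mem`). -/

noncomputable section

/-! ### Ordered tuples of points: cones, subdivision and prisms. -/

namespace PersistenceDiagram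

variable {k : Type*} [Field k]

/-! ### Alternating sums of faces -/

/-- The linear extension of the alternating sum of a finite family of face maps. -/
def alternatingSum (k : Type*) [Field k] {A B : Type*} {n : ℕ} (d : Fin n → A → B) :
    (A →₀ k) →ₗ[k] (B →₀ k) :=
  Finsupp.linearCombination k fun x => ∑ i : Fin n, (-1 : k) ^ (i : ℕ) • Finsupp.single (d i x) 1

theorem alternatingSum_single {A B : Type*} {n : ℕ} (d : Fin n → A → B) (x : A) :
    alternatingSum k d (Finsupp.single x 1) =
      ∑ i : Fin n, (-1 : k) ^ (i : ℕ) • Finsupp.single (d i x) 1 := by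
  simp [alternatingSum]

theorem lmapDomain_alternatingSum {A A' B B' : Type*} {n : ℕ} {d : Fin n → A → B}
    {d' : Fin n → A' → B'} {f : A → A'} {g : B → B'} (h : ∀ i x, g (d i x) = d' i (f x))
    (z : A →₀ k) :
    Finsupp.lmapDomain k k g (alternatingSum k d z) =
      alternatingSum k d' (Finsupp.lmapDomain k k f z) := by
  suffices H : Finsupp.lmapDomain k k g ∘ₗ alternatingSum k d =
      alternatingSum k d' ∘ₗ Finsupp.lmapDomain k k f from LinearMap.congr_fun H z
  apply Finsupp.lhom_ext'
  intro x
  ext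
  simp [alternatingSum_single, Finsupp.mapDomain_single, map_sum, h]

/-- A linear map defined on basis vectors sends a supported submodule into `W` as soon as the
basis vectors go there. -/
theorem map_mem_of_supported {A M : Type*} [AddCommGroup M] [Module k M] {s : Set A}
    {W : Submodule k M} (f : (A →₀ k) →ₗ[k] M)
    (h : ∀ x ∈ s, f (Finsupp.single x 1) ∈ W) {z : A →₀ k} (hz : z ∈ Finsupp.supported k k s) :
    f z ∈ W := by
  rw [Finsupp.supported_eq_span_single] at hz
  have : Submodule.span k ((fun i => Finsupp.single i (1 : k)) '' s) ≤ W.comap f := by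
    rw [Submodule.span_le]
    rintro _ ⟨x, hx, rfl⟩
    exact h x hx
  exact this hz

theorem alternatingSum_mem_supported {A B : Type*} {n : ℕ} {d : Fin n → A → B} {s : Set A}
    {t : Set B} (h : ∀ i, ∀ x ∈ s, d i x ∈ t) {z : A →₀ k} (hz : z ∈ Finsupp.supported k k s) :
    alternatingSum k d z ∈ Finsupp.supported k k t := by
  refine map_mem_of_supported _ (fun x hx => ?_) hz
  rw [alternatingSum_single]
  exact Submodule.sum_mem _ fun i _ =>
    Submodule.smul_mem _ _ (Finsupp.single_mem_supported k _ (h i x hx))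

theorem lmapDomain_mem_supported {A B : Type*} {f : A → B} {s : Set A}
    {t : Set B} (h : ∀ x ∈ s, f x ∈ t) {z : A →₀ k} (hz : z ∈ Finsupp.supported k k s) :
    Finsupp.lmapDomain k k f z ∈ Finsupp.supported k k t := by
  refine map_mem_of_supported _ (fun x hx => ?_) hz
  rw [Finsupp.lmapDomain_apply, Finsupp.mapDomain_single]
  exact Finsupp.single_mem_supported k _ (h x hx)

/-! ### The complex of tuples -/

/-- Linear combinations of tuples of `n` points of `Y`. -/
abbrev TupleChain (k : Type*) [Field k] (Y : Type*) (n : ℕ) := (Fin n → Y) →₀ k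

/-- The (augmented) boundary of tuples. -/
def tupleBoundary (k : Type*) [Field k] (Y : Type*) (n : ℕ) :
    TupleChain k Y (n + 1) →ₗ[k] TupleChain k Y n :=
  alternatingSum k fun i w => i.removeNth w

/-- The map on tuple chains induced by a map of points. -/
def tupleMap (k : Type*) [Field k] {Y Y' : Type*} (f : Y → Y') (n : ℕ) :
    TupleChain k Y n →ₗ[k] TupleChain k Y' n :=
  Finsupp.lmapDomain k k (f ∘ ·)

/-- Prepending a point to tuples. -/
def tupleCone (k : Type*) [Field k] {Y : Type*} (a : Y) (n : ℕ) :
    TupleChain k Y n →ₗ[k] TupleChain k Y (n + 1) :=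
  Finsupp.lmapDomain k k (fun w => (Fin.cons a w : Fin (n + 1) → Y))

section Tuples

variable {Y Y' Y'' : Type*}

theorem tupleBoundary_single {n : ℕ} (w : Fin (n + 1) → Y) :
    tupleBoundary k Y n (Finsupp.single w 1) =
      ∑ i : Fin (n + 1), (-1 : k) ^ (i : ℕ) • Finsupp.single (i.removeNth w) 1 :=
  alternatingSum_single _ _

@[simp] theorem tupleMap_single (f : Y → Y') {n : ℕ} (w : Fin n → Y) (c : k) :
    tupleMap k f n (Finsupp.single w c) = Finsupp.single (f ∘ w) c := by
  simp [tupleMap, Finsupp.mapDomain_single]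

@[simp] theorem tupleCone_single (a : Y) {n : ℕ} (w : Fin n → Y) (c : k) :
    tupleCone k a n (Finsupp.single w c) = Finsupp.single (Fin.cons a w : Fin (n + 1) → Y) c := by
  simp [tupleCone, Finsupp.mapDomain_single]

theorem tupleMap_comp_apply (f : Y → Y') (g : Y' → Y'') {n : ℕ} (z : TupleChain k Y n) :
    tupleMap k g n (tupleMap k f n z) = tupleMap k (g ∘ f) n z := by
  simp only [tupleMap, Finsupp.lmapDomain_apply, ← Finsupp.mapDomain_comp]
  rfl

theorem tupleMap_tupleBoundary (f : Y → Y') {n : ℕ} (z : TupleChain k Y (n + 1)) :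
    tupleMap k f n (tupleBoundary k Y n z) = tupleBoundary k Y' n (tupleMap k f (n + 1) z) := by
  have h : ∀ (i : Fin (n + 1)) (w : Fin (n + 1) → Y),
      f ∘ i.removeNth w = i.removeNth (f ∘ w) := fun i w => rfl
  unfold tupleMap tupleBoundary
  exact lmapDomain_alternatingSum h z

theorem tupleMap_tupleCone (f : Y → Y') (a : Y) {n : ℕ} (z : TupleChain k Y n) :
    tupleMap k f (n + 1) (tupleCone k a n z) = tupleCone k (f a) n (tupleMap k f n z) := by
  simp only [tupleMap, tupleCone, Finsupp.lmapDomain_apply, ← Finsupp.mapDomain_comp]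
  congr 1
  funext w
  exact Fin.comp_cons f a w

theorem tupleBoundary_tupleCone_zero (a : Y) (z : TupleChain k Y 0) :
    tupleBoundary k Y 0 (tupleCone k a 0 z) = z := by
  suffices H : tupleBoundary k Y 0 ∘ₗ tupleCone k a 0 = LinearMap.id from LinearMap.congr_fun H z
  apply Finsupp.lhom_ext'
  intro x
  ext1
  simp [tupleBoundary_single]

/-- Deleting the apex returns the tuple; deleting a later entry commutes with coning but shifts the
sign. Hence coning contracts the augmented complex, and a cycle is the boundary of its cone. -/
theorem tupleBoundary_tupleCone (a : Y) {n : ℕ} (z : TupleChain k Y (n + 1)) :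
    tupleBoundary k Y (n + 1) (tupleCone k a (n + 1) z) =
      z - tupleCone k a n (tupleBoundary k Y n z) := by
  suffices H : tupleBoundary k Y (n + 1) ∘ₗ tupleCone k a (n + 1) =
    LinearMap.id - tupleCone k a n ∘ₗ tupleBoundary k Y n from LinearMap.congr_fun H z
  apply Finsupp.lhom_ext'
  intro w
  ext1
  have h : ∀ i : Fin (n + 1), i.succ.removeNth (Fin.cons a w : Fin (n + 2) → Y) =
      Fin.cons a (i.removeNth w) := fun i => Fin.cons_comp_succ_succAbove a w i
  simp [tupleBoundary_single, Fin.sum_univ_succ (n := n + 1), h, pow_succ, sub_eq_add_neg]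

/-- Every nonempty tuple is the cone from its head over its tail, so the cone formula and induction
replace the usual cancellation in a double sum. -/
theorem tupleBoundary_tupleBoundary {n : ℕ} (z : TupleChain k Y (n + 2)) :
    tupleBoundary k Y n (tupleBoundary k Y (n + 1) z) = 0 := by
  suffices H : tupleBoundary k Y n ∘ₗ tupleBoundary k Y (n + 1) = 0 from LinearMap.congr_fun H z
  apply Finsupp.lhom_ext'
  intro w
  ext1
  simp only [LinearMap.comp_apply, Finsupp.lsingle_apply, LinearMap.zero_apply]
  induction n with
  | zero =>
    rw [← Fin.cons_self_tail w, ← tupleCone_single, tupleBoundary_tupleCone, map_sub,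
      tupleBoundary_tupleCone_zero, sub_self]
  | succ n ih =>
    rw [← Fin.cons_self_tail w, ← tupleCone_single, tupleBoundary_tupleCone, map_sub,
      tupleBoundary_tupleCone, ih (Finsupp.single (Fin.tail w) 1), map_zero, sub_zero, sub_self]

theorem tupleCone_mem_supported {a : Y} {n : ℕ} {s : Set (Fin n → Y)}
    {t : Set (Fin (n + 1) → Y)} (h : ∀ w ∈ s, (Fin.cons a w : Fin (n + 1) → Y) ∈ t)
    {z : TupleChain k Y n} (hz : z ∈ Finsupp.supported k k s) :
    tupleCone k a n z ∈ Finsupp.supported k k t :=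
  lmapDomain_mem_supported h hz

theorem tupleBoundary_mem_supported {n : ℕ} {s : Set (Fin (n + 1) → Y)}
    {t : Set (Fin n → Y)} (h : ∀ i, ∀ w ∈ s, Fin.removeNth i w ∈ t)
    {z : TupleChain k Y (n + 1)} (hz : z ∈ Finsupp.supported k k s) :
    tupleBoundary k Y n z ∈ Finsupp.supported k k t :=
  alternatingSum_mem_supported h hz

end Tuples

/-! ### Chain homotopies built from cones -/

section Homotopy

variable {Y Y' Z Z' : Type*}

/-- The chain homotopy obtained by successively filling `R w - J (∂ w)` by the cone with apex
`b w`. -/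
def coneHomotopy (R : ∀ n, TupleChain k Y n →ₗ[k] TupleChain k Z n)
    (b : ∀ n, (Fin (n + 1) → Y) → Z) : ∀ n, TupleChain k Y n →ₗ[k] TupleChain k Z (n + 1)
  | 0 => 0
  | n + 1 => Finsupp.linearCombination k fun w =>
      tupleCone k (b n w) (n + 1) (R (n + 1) (Finsupp.single w 1) -
        coneHomotopy R b n (tupleBoundary k Y n (Finsupp.single w 1)))

theorem coneHomotopy_succ_single (R : ∀ n, TupleChain k Y n →ₗ[k] TupleChain k Z n)
    (b : ∀ n, (Fin (n + 1) → Y) → Z) {n : ℕ} (w : Fin (n + 1) → Y) :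
    coneHomotopy R b (n + 1) (Finsupp.single w 1) =
      tupleCone k (b n w) (n + 1) (R (n + 1) (Finsupp.single w 1) -
        coneHomotopy R b n (tupleBoundary k Y n (Finsupp.single w 1))) := by
  simp [coneHomotopy]

/-- The chain `R w - J (∂ w)` is a cycle: by induction `∂ J ∂ w = R ∂ w - J ∂ ∂ w = R ∂ w`. Its cone
therefore has it as boundary, whatever apex is chosen; the condition `R 0 = 0` starts the induction.
-/
theorem tupleBoundary_coneHomotopy {R : ∀ n, TupleChain k Y n →ₗ[k] TupleChain k Z n}
    (b : ∀ n, (Fin (n + 1) → Y) → Z) (hR0 : R 0 = 0)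
    (hR : ∀ n z, tupleBoundary k Z n (R (n + 1) z) = R n (tupleBoundary k Y n z)) (n : ℕ)
    (z : TupleChain k Y (n + 1)) :
    tupleBoundary k Z (n + 1) (coneHomotopy R b (n + 1) z) =
      R (n + 1) z - coneHomotopy R b n (tupleBoundary k Y n z) := by
  induction n with
  | zero =>
    suffices H : tupleBoundary k Z 1 ∘ₗ coneHomotopy R b 1 =
        R 1 - coneHomotopy R b 0 ∘ₗ tupleBoundary k Y 0 from LinearMap.congr_fun H z
    apply Finsupp.lhom_ext'
    intro w
    ext1
    simp only [LinearMap.comp_apply, Finsupp.lsingle_apply, LinearMap.sub_apply,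
      coneHomotopy_succ_single, tupleBoundary_tupleCone]
    simp [coneHomotopy, hR, hR0]
  | succ n ih =>
    suffices H : tupleBoundary k Z (n + 2) ∘ₗ coneHomotopy R b (n + 2) =
        R (n + 2) - coneHomotopy R b (n + 1) ∘ₗ tupleBoundary k Y (n + 1) from
      LinearMap.congr_fun H z
    apply Finsupp.lhom_ext'
    intro w
    ext1
    simp only [LinearMap.comp_apply, Finsupp.lsingle_apply, LinearMap.sub_apply]
    rw [coneHomotopy_succ_single, tupleBoundary_tupleCone, map_sub, ih, hR,
      tupleBoundary_tupleBoundary, map_zero, sub_zero, sub_self, map_zero, sub_zero]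

/-- Apexes may be arbitrary for the boundary formula, but must be compatible with the maps for
naturality. -/
theorem tupleMap_coneHomotopy {R : ∀ n, TupleChain k Y n →ₗ[k] TupleChain k Z n}
    {R' : ∀ n, TupleChain k Y' n →ₗ[k] TupleChain k Z' n}
    {b : ∀ n, (Fin (n + 1) → Y) → Z} {b' : ∀ n, (Fin (n + 1) → Y') → Z'}
    {f : Y → Y'} {g : Z → Z'}
    (hb : ∀ n w, g (b n w) = b' n (f ∘ w))
    (hR : ∀ n z, tupleMap k g n (R n z) = R' n (tupleMap k f n z)) (n : ℕ)
    (z : TupleChain k Y n) :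
    tupleMap k g (n + 1) (coneHomotopy R b n z) = coneHomotopy R' b' n (tupleMap k f n z) := by
  induction n with
  | zero => simp [coneHomotopy]
  | succ n ih =>
    suffices H : tupleMap k g (n + 2) ∘ₗ coneHomotopy R b (n + 1) =
        coneHomotopy R' b' (n + 1) ∘ₗ tupleMap k f (n + 1) from LinearMap.congr_fun H z
    apply Finsupp.lhom_ext'
    intro w
    ext1
    simp only [LinearMap.comp_apply, Finsupp.lsingle_apply]
    rw [coneHomotopy_succ_single, tupleMap_tupleCone, map_sub, ih, hR, hb, tupleMap_single,
      coneHomotopy_succ_single, tupleMap_tupleBoundary, tupleMap_single]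

end Homotopy

/-! ### Subdivision of tuples -/

section Subdivision

variable {Y Y' : Type*}

/-- Subdivision of tuples, where `b` chooses the apex placed inside each tuple. -/
def tupleSubdivision (k : Type*) [Field k] (b : ∀ n, (Fin (n + 1) → Y) → Y) :
    ∀ n, TupleChain k Y n →ₗ[k] TupleChain k Y n
  | 0 => LinearMap.id
  | n + 1 => Finsupp.linearCombination k fun w =>
      tupleCone k (b n w) n (tupleSubdivision k b n (tupleBoundary k Y n (Finsupp.single w 1)))

variable {b : ∀ n, (Fin (n + 1) → Y) → Y} {b' : ∀ n, (Fin (n + 1) → Y') → Y'}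

theorem tupleSubdivision_succ_single {n : ℕ} (w : Fin (n + 1) → Y) :
    tupleSubdivision k b (n + 1) (Finsupp.single w 1) =
      tupleCone k (b n w) n
        (tupleSubdivision k b n (tupleBoundary k Y n (Finsupp.single w 1))) := by
  simp [tupleSubdivision]

/-- The subdivided boundary is a cycle by induction, so coning it from the apex fills it without a
correction term. -/
theorem tupleBoundary_tupleSubdivision (n : ℕ) (z : TupleChain k Y (n + 1)) :
    tupleBoundary k Y n (tupleSubdivision k b (n + 1) z) =
      tupleSubdivision k b n (tupleBoundary k Y n z) := by
  induction n with
  | zero =>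
    suffices H : tupleBoundary k Y 0 ∘ₗ tupleSubdivision k b 1 =
        tupleSubdivision k b 0 ∘ₗ tupleBoundary k Y 0 from LinearMap.congr_fun H z
    apply Finsupp.lhom_ext'
    intro w
    ext1
    simp only [LinearMap.comp_apply, Finsupp.lsingle_apply]
    rw [tupleSubdivision_succ_single, tupleBoundary_tupleCone_zero]
  | succ n ih =>
    suffices H : tupleBoundary k Y (n + 1) ∘ₗ tupleSubdivision k b (n + 2) =
        tupleSubdivision k b (n + 1) ∘ₗ tupleBoundary k Y (n + 1) from LinearMap.congr_fun H z
    apply Finsupp.lhom_ext'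
    intro w
    ext1
    simp only [LinearMap.comp_apply, Finsupp.lsingle_apply]
    rw [tupleSubdivision_succ_single, tupleBoundary_tupleCone, ih, tupleBoundary_tupleBoundary,
      map_zero, map_zero, sub_zero]

theorem tupleMap_tupleSubdivision {f : Y → Y'} (hb : ∀ n w, f (b n w) = b' n (f ∘ w)) (n : ℕ)
    (z : TupleChain k Y n) :
    tupleMap k f n (tupleSubdivision k b n z) = tupleSubdivision k b' n (tupleMap k f n z) := by
  induction n with
  | zero => rfl
  | succ n ih =>
    suffices H : tupleMap k f (n + 1) ∘ₗ tupleSubdivision k b (n + 1) =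
        tupleSubdivision k b' (n + 1) ∘ₗ tupleMap k f (n + 1) from LinearMap.congr_fun H z
    apply Finsupp.lhom_ext'
    intro w
    ext1
    simp only [LinearMap.comp_apply, Finsupp.lsingle_apply]
    rw [tupleSubdivision_succ_single, tupleMap_tupleCone, ih, hb, tupleMap_single,
      tupleSubdivision_succ_single, tupleMap_tupleBoundary, tupleMap_single]

/-- The prism from `Y × {q₀}` to the subdivision of `Y × {q₁}`. -/
def tuplePrism (k : Type*) [Field k] {Q : Type*} (q₀ q₁ : Q) (b : ∀ n, (Fin (n + 1) → Y) → Y) :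
    ∀ n, TupleChain k Y n →ₗ[k] TupleChain k (Y × Q) (n + 1) :=
  coneHomotopy (fun n => tupleMap k (fun y => (y, q₀)) n -
    tupleMap k (fun y => (y, q₁)) n ∘ₗ tupleSubdivision k b n) fun _ w => (w 0, q₀)

theorem tupleBoundary_tuplePrism {Q : Type*} (q₀ q₁ : Q) (n : ℕ) (z : TupleChain k Y (n + 1)) :
    tupleBoundary k (Y × Q) (n + 1) (tuplePrism k q₀ q₁ b (n + 1) z) =
      tupleMap k (fun y => (y, q₀)) (n + 1) z -
        tupleMap k (fun y => (y, q₁)) (n + 1) (tupleSubdivision k b (n + 1) z) -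
      tuplePrism k q₀ q₁ b n (tupleBoundary k Y n z) := by
  refine tupleBoundary_coneHomotopy _ ?_ (fun n z => ?_) n z
  · apply Finsupp.lhom_ext'
    intro w
    ext1
    simp only [LinearMap.comp_apply, Finsupp.lsingle_apply, LinearMap.sub_apply, tupleSubdivision,
      LinearMap.id_apply, tupleMap_single, LinearMap.zero_apply]
    -- Both ends of the prism over the empty tuple are the unique empty tuple.
    rw [sub_eq_zero]
    congr 1
    exact Subsingleton.elim _ _
  · simp only [LinearMap.comp_apply, LinearMap.sub_apply, map_sub, ← tupleMap_tupleBoundary,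
      tupleBoundary_tupleSubdivision]

theorem tupleMap_tuplePrism {Q : Type*} (q₀ q₁ : Q) {f : Y → Y'}
    (hb : ∀ n w, f (b n w) = b' n (f ∘ w)) (n : ℕ) (z : TupleChain k Y n) :
    tupleMap k (Prod.map f id) (n + 1) (tuplePrism k q₀ q₁ b n z) =
      tuplePrism k q₀ q₁ b' n (tupleMap k f n z) := by
  refine tupleMap_coneHomotopy (fun n w => rfl) (fun n z => ?_) n z
  simp only [LinearMap.comp_apply, LinearMap.sub_apply, map_sub, ← tupleMap_tupleSubdivision hb,
    tupleMap_comp_apply]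
  rfl

end Subdivision

end PersistenceDiagram

end

/-! ### Singular chains: barycentric subdivision and homotopies. -/

noncomputable section

namespace PersistenceDiagram

variable {k : Type*} [Field k]

/-! ### Affine maps of standard simplices -/

section Affine

variable {ι κ : Type*} [Fintype ι] [Fintype κ]

/-- The affine map from a standard simplex that sends the vertices to given points. -/
def affineSimplex {m : ℕ} (w : Fin m → stdSimplex ℝ ι) :
    C(stdSimplex ℝ (Fin m), stdSimplex ℝ ι) where
  toFun t := ⟨∑ j, t.1 j • (w j).1,
    (convex_stdSimplex ℝ ι).sum_mem (fun j _ => t.2.1 j) t.2.2 fun j _ => (w j).2⟩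
  continuous_toFun := by
    refine Continuous.subtype_mk (continuous_finsetSum _ fun j _ => ?_) _
    exact ((continuous_apply j).comp continuous_subtype_val).smul continuous_const

theorem affineSimplex_coe {m : ℕ} (w : Fin m → stdSimplex ℝ ι) (t : stdSimplex ℝ (Fin m)) :
    (affineSimplex w t).1 = ∑ j, t.1 j • (w j).1 := rfl

theorem affineSimplex_comp_apply {m l : ℕ} (w : Fin m → stdSimplex ℝ ι)
    (u : Fin l → stdSimplex ℝ (Fin m)) (t : stdSimplex ℝ (Fin l)) :
    affineSimplex (affineSimplex w ∘ u) t = affineSimplex w (affineSimplex u t) := by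
  apply Subtype.ext
  simp only [affineSimplex_coe, Function.comp_apply, Finset.smul_sum, Finset.sum_apply,
    Pi.smul_apply, Finset.sum_smul, smul_smul, smul_eq_mul]
  exact Finset.sum_comm

theorem affineSimplex_vertex_comp {m l : ℕ} (w : Fin m → stdSimplex ℝ ι) (f : Fin l → Fin m) :
    affineSimplex w ∘ (stdSimplex.vertex (S := ℝ) ∘ f) = w ∘ f := by
  funext j
  apply Subtype.ext
  simp [affineSimplex_coe, stdSimplex.vertex, Pi.single_apply, ite_smul]

theorem affineSimplex_vertex (m : ℕ) :
    affineSimplex (stdSimplex.vertex (S := ℝ) : Fin m → _) = ContinuousMap.id _ := by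
  ext t i
  change ((affineSimplex (stdSimplex.vertex (S := ℝ) : Fin m → _)) t).1 i = t.1 i
  simp [affineSimplex_coe, Finset.sum_apply, Pi.single_apply]

/-- The inclusion of the `i`-th face of a standard simplex. -/
def coface {n : ℕ} (i : Fin (n + 1)) : C(stdSimplex ℝ (Fin n), stdSimplex ℝ (Fin (n + 1))) :=
  ⟨stdSimplex.map i.succAbove, stdSimplex.continuous_map _⟩

theorem coface_eq_affineSimplex {n : ℕ} (i : Fin (n + 1)) :
    coface i = affineSimplex (stdSimplex.vertex (S := ℝ) ∘ i.succAbove) := by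
  ext t l
  change (stdSimplex.map i.succAbove t : Fin (n + 1) → ℝ) l =
    (affineSimplex (stdSimplex.vertex (S := ℝ) ∘ i.succAbove) t).1 l
  rw [stdSimplex.map_coe, FunOnFinite.linearMap_apply_apply]
  simp only [affineSimplex_coe, Function.comp_apply, stdSimplex.vertex, Finset.sum_apply,
    Pi.smul_apply, Pi.single_apply, smul_eq_mul, mul_ite, mul_one, mul_zero, Finset.sum_filter]
  exact Finset.sum_congr rfl fun j _ => by simp only [eq_comm]; rfl

theorem affineSimplex_removeNth {n : ℕ} (w : Fin (n + 1) → stdSimplex ℝ ι) (i : Fin (n + 1)) :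
    affineSimplex (i.removeNth w) = (affineSimplex w).comp (coface i) := by
  ext1 t
  rw [coface_eq_affineSimplex, ContinuousMap.comp_apply, ← affineSimplex_comp_apply,
    affineSimplex_vertex_comp]
  rfl

theorem coface_vertex {n : ℕ} (i : Fin (n + 1)) :
    (coface i ∘ stdSimplex.vertex (S := ℝ) : Fin n → _) =
      i.removeNth (stdSimplex.vertex (S := ℝ)) := by
  rw [coface_eq_affineSimplex]
  exact affineSimplex_vertex_comp _ id

/-- The barycenter of a nonempty tuple of points in a standard simplex. -/
def tupleBarycenter (ι : Type*) [Fintype ι] (n : ℕ) (w : Fin (n + 1) → stdSimplex ℝ ι) :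
    stdSimplex ℝ ι :=
  affineSimplex w stdSimplex.barycenter

theorem affineSimplex_tupleBarycenter {m : ℕ} (w : Fin m → stdSimplex ℝ ι) (n : ℕ)
    (u : Fin (n + 1) → stdSimplex ℝ (Fin m)) :
    affineSimplex w (tupleBarycenter (Fin m) n u) =
      tupleBarycenter ι n (affineSimplex w ∘ u) :=
  (affineSimplex_comp_apply w u _).symm

/-- The affine map from a standard simplex to a product of standard simplices that sends the
vertices to given points. -/
def affineSimplexProd {m : ℕ} (w : Fin m → stdSimplex ℝ ι × stdSimplex ℝ κ) :
    C(stdSimplex ℝ (Fin m), stdSimplex ℝ ι × stdSimplex ℝ κ) :=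
  (affineSimplex (Prod.fst ∘ w)).prodMk (affineSimplex (Prod.snd ∘ w))

theorem affineSimplexProd_removeNth {n : ℕ} (w : Fin (n + 1) → stdSimplex ℝ ι × stdSimplex ℝ κ)
    (i : Fin (n + 1)) :
    affineSimplexProd (i.removeNth w) = (affineSimplexProd w).comp (coface i) := by
  have h₁ := affineSimplex_removeNth (Prod.fst ∘ w) i
  have h₂ := affineSimplex_removeNth (Prod.snd ∘ w) i
  ext1 t
  exact Prod.ext (DFunLike.congr_fun h₁ t) (DFunLike.congr_fun h₂ t)

end Affine

/-! ### Singular chains -/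

section Singular

variable {X : Type*} [TopologicalSpace X]

/-- Singular chains on `X` spanned by the singular simplices with `n` vertices. -/
abbrev SingularChain (k : Type*) [Field k] (X : Type*) [TopologicalSpace X] (n : ℕ) :=
  C(stdSimplex ℝ (Fin n), X) →₀ k

/-- The (augmented) boundary of singular chains. -/
def singularBoundary (k : Type*) [Field k] (X : Type*) [TopologicalSpace X] (n : ℕ) :
    SingularChain k X (n + 1) →ₗ[k] SingularChain k X n :=
  alternatingSum k fun i σ => σ.comp (coface i)

/-- The singular simplices of `X` with `n` vertices and values in `Z`. -/
def simplicesIn (n : ℕ) (Z : Set X) : Set C(stdSimplex ℝ (Fin n), X) := {σ | ∀ t, σ t ∈ Z}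

/-- The singular chain in `X` obtained from a chain of tuples in `Y`, a way `a` of spanning
singular simplices in `Y`, and a continuous map `Y → X`. -/
def pushforward {Y : Type*} [TopologicalSpace Y] (k : Type*) [Field k]
    (a : ∀ m, (Fin m → Y) → C(stdSimplex ℝ (Fin m), Y)) (g : C(Y, X)) (m : ℕ) :
    TupleChain k Y m →ₗ[k] SingularChain k X m :=
  Finsupp.lmapDomain k k fun w => g.comp (a m w)

section Pushforward

variable {Y Y' : Type*} [TopologicalSpace Y] [TopologicalSpace Y']
  {a : ∀ m, (Fin m → Y) → C(stdSimplex ℝ (Fin m), Y)}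
  {a' : ∀ m, (Fin m → Y') → C(stdSimplex ℝ (Fin m), Y')}

@[simp] theorem pushforward_single (g : C(Y, X)) {m : ℕ} (w : Fin m → Y) (c : k) :
    pushforward k a g m (Finsupp.single w c) = Finsupp.single (g.comp (a m w)) c := by
  simp [pushforward, Finsupp.mapDomain_single]

theorem singularBoundary_pushforward
    (ha : ∀ n (w : Fin (n + 1) → Y) i, a n (i.removeNth w) = (a (n + 1) w).comp (coface i))
    (g : C(Y, X)) {m : ℕ} (z : TupleChain k Y (m + 1)) :
    singularBoundary k X m (pushforward k a g (m + 1) z) =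
      pushforward k a g m (tupleBoundary k Y m z) := by
  have h : ∀ (i : Fin (m + 1)) (w : Fin (m + 1) → Y),
      g.comp (a m (i.removeNth w)) = (g.comp (a (m + 1) w)).comp (coface i) := fun i w => by
    rw [ha, ContinuousMap.comp_assoc]
  unfold singularBoundary pushforward tupleBoundary
  exact (lmapDomain_alternatingSum h z).symm

theorem pushforward_comp (g : C(Y, X)) (f : C(Y', Y)) {m : ℕ}
    (hf : ∀ w, a m (f ∘ w) = f.comp (a' m w)) (z : TupleChain k Y' m) :
    pushforward k a' (g.comp f) m z = pushforward k a g m (tupleMap k f m z) := by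
  simp only [pushforward, tupleMap, Finsupp.lmapDomain_apply, ← Finsupp.mapDomain_comp]
  congr 1
  funext w
  simp [hf, ContinuousMap.comp_assoc]

theorem pushforward_mem_supported {g : C(Y, X)} {Z : Set X} (hg : ∀ y, g y ∈ Z) {m : ℕ}
    (z : TupleChain k Y m) : pushforward k a g m z ∈ Finsupp.supported k k (simplicesIn m Z) :=
  lmapDomain_mem_supported (s := Set.univ) (t := simplicesIn m Z) (fun w _ t => hg (a m w t))
    (by simp)

end Pushforward

/-- Pushing forward tuples in a standard simplex along a singular simplex. -/
abbrev pushSimplex {n : ℕ} (σ : C(stdSimplex ℝ (Fin n), X)) (m : ℕ) :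
    TupleChain k (stdSimplex ℝ (Fin n)) m →ₗ[k] SingularChain k X m :=
  pushforward k (fun _ => affineSimplex) σ m

theorem pushSimplex_comp_affineSimplex {n l m : ℕ} (σ : C(stdSimplex ℝ (Fin n), X))
    (w : Fin l → stdSimplex ℝ (Fin n)) (z : TupleChain k (stdSimplex ℝ (Fin l)) m) :
    pushSimplex (σ.comp (affineSimplex w)) m z =
      pushSimplex σ m (tupleMap k (affineSimplex w) m z) :=
  pushforward_comp _ _ (fun u => by ext1 t; exact affineSimplex_comp_apply w u t) z

/-- The chain consisting of the tuple of vertices of the standard simplex. -/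
abbrev vertexTuple (k : Type*) [Field k] (n : ℕ) : TupleChain k (stdSimplex ℝ (Fin n)) n :=
  Finsupp.single (stdSimplex.vertex (S := ℝ)) 1

theorem tupleMap_affineSimplex_vertexTuple {ι : Type*} [Fintype ι] {n : ℕ}
    (w : Fin n → stdSimplex ℝ ι) :
    tupleMap k (affineSimplex w) n (vertexTuple k n) = Finsupp.single w 1 := by
  rw [tupleMap_single]
  congr 1
  exact affineSimplex_vertex_comp w id

/-- Barycentric subdivision of singular chains. -/
def singularSubdivision (k : Type*) [Field k] (X : Type*) [TopologicalSpace X] (n : ℕ) :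
    SingularChain k X n →ₗ[k] SingularChain k X n :=
  Finsupp.linearCombination k fun σ =>
    pushSimplex σ n (tupleSubdivision k (tupleBarycenter (Fin n)) n (vertexTuple k n))

theorem singularSubdivision_single {n : ℕ} (σ : C(stdSimplex ℝ (Fin n), X)) :
    singularSubdivision k X n (Finsupp.single σ 1) =
      pushSimplex σ n (tupleSubdivision k (tupleBarycenter (Fin n)) n (vertexTuple k n)) := by
  simp [singularSubdivision]

/-- Affine maps preserve barycenters, so subdivision may be carried out in the model simplex. This
reduces the formulas for singular chains to those for tuples. -/
theorem singularSubdivision_pushSimplex {n m : ℕ} (σ : C(stdSimplex ℝ (Fin n), X))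
    (z : TupleChain k (stdSimplex ℝ (Fin n)) m) :
    singularSubdivision k X m (pushSimplex σ m z) =
      pushSimplex σ m (tupleSubdivision k (tupleBarycenter (Fin n)) m z) := by
  suffices H : singularSubdivision k X m ∘ₗ pushSimplex σ m =
      pushSimplex σ m ∘ₗ tupleSubdivision k (tupleBarycenter (Fin n)) m from
    LinearMap.congr_fun H z
  apply Finsupp.lhom_ext'
  intro w
  ext1
  simp only [LinearMap.comp_apply, Finsupp.lsingle_apply, pushforward_single]
  rw [singularSubdivision_single, pushSimplex_comp_affineSimplex,
    tupleMap_tupleSubdivision (affineSimplex_tupleBarycenter w),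
    tupleMap_affineSimplex_vertexTuple]

theorem singularBoundary_pushSimplex {n m : ℕ} (σ : C(stdSimplex ℝ (Fin n), X))
    (z : TupleChain k (stdSimplex ℝ (Fin n)) (m + 1)) :
    singularBoundary k X m (pushSimplex σ (m + 1) z) =
      pushSimplex σ m (tupleBoundary k _ m z) :=
  singularBoundary_pushforward (fun _ w i => affineSimplex_removeNth w i) σ z

theorem pushSimplex_vertexTuple {n : ℕ} (σ : C(stdSimplex ℝ (Fin n), X)) :
    pushSimplex σ n (vertexTuple k n) = Finsupp.single σ 1 := by
  rw [pushforward_single, affineSimplex_vertex, ContinuousMap.comp_id]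

theorem singularBoundary_singularSubdivision {n : ℕ} (z : SingularChain k X (n + 1)) :
    singularBoundary k X n (singularSubdivision k X (n + 1) z) =
      singularSubdivision k X n (singularBoundary k X n z) := by
  suffices H : singularBoundary k X n ∘ₗ singularSubdivision k X (n + 1) =
      singularSubdivision k X n ∘ₗ singularBoundary k X n from LinearMap.congr_fun H z
  apply Finsupp.lhom_ext'
  intro σ
  ext1
  simp only [LinearMap.comp_apply, Finsupp.lsingle_apply]
  rw [singularSubdivision_single, singularBoundary_pushSimplex, tupleBoundary_tupleSubdivision,
    ← singularSubdivision_pushSimplex, ← singularBoundary_pushSimplex, pushSimplex_vertexTuple]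

theorem singularSubdivision_mem_supported {n : ℕ} {Z : Set X} {z : SingularChain k X n}
    (hz : z ∈ Finsupp.supported k k (simplicesIn n Z)) :
    singularSubdivision k X n z ∈ Finsupp.supported k k (simplicesIn n Z) :=
  map_mem_of_supported _ (fun σ hσ => by
    rw [singularSubdivision_single]; exact pushforward_mem_supported hσ _) hz

/-! ### Homotopies of singular chains -/

/-- A homotopy, natural with respect to faces, from each singular simplex `σ` to another one. -/
structure SimplexHomotopy (X : Type*) [TopologicalSpace X] where
  /-- The homotopy starting at a singular simplex. -/
  toMap : ∀ {n : ℕ}, C(stdSimplex ℝ (Fin n), X) →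
    C(stdSimplex ℝ (Fin n) × stdSimplex ℝ (Fin 2), X)
  /-- The end of the homotopy. -/
  target : ∀ {n : ℕ}, C(stdSimplex ℝ (Fin n), X) → C(stdSimplex ℝ (Fin n), X)
  map_zero : ∀ {n : ℕ} (σ : C(stdSimplex ℝ (Fin n), X)) x,
    toMap σ (x, stdSimplex.vertex 0) = σ x
  map_one : ∀ {n : ℕ} (σ : C(stdSimplex ℝ (Fin n), X)) x,
    toMap σ (x, stdSimplex.vertex 1) = target σ x
  map_face : ∀ {n : ℕ} (σ : C(stdSimplex ℝ (Fin (n + 1)), X)) (i : Fin (n + 1)) p,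
    toMap (σ.comp (coface i)) p = toMap σ (Prod.map (coface i) id p)

variable (h : SimplexHomotopy X)

/-- The chain homotopy induced by a homotopy of singular simplices. -/
def SimplexHomotopy.prism (k : Type*) [Field k] (n : ℕ) :
    SingularChain k X n →ₗ[k] SingularChain k X (n + 1) :=
  Finsupp.linearCombination k fun σ =>
    pushforward k (fun _ => affineSimplexProd) (h.toMap σ) (n + 1)
      (tuplePrism k (stdSimplex.vertex 0) (stdSimplex.vertex 1) (tupleBarycenter (Fin n)) n
        (vertexTuple k n))

theorem SimplexHomotopy.prism_single {n : ℕ} (σ : C(stdSimplex ℝ (Fin n), X)) :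
    h.prism k n (Finsupp.single σ 1) =
      pushforward k (fun _ => affineSimplexProd) (h.toMap σ) (n + 1)
        (tuplePrism k (stdSimplex.vertex 0) (stdSimplex.vertex 1) (tupleBarycenter (Fin n)) n
          (vertexTuple k n)) := by
  rw [prism, Finsupp.linearCombination_single, one_smul]

theorem SimplexHomotopy.prism_zero : h.prism k 0 = 0 := by
  apply Finsupp.lhom_ext'
  intro σ
  ext1
  simp only [LinearMap.comp_apply, Finsupp.lsingle_apply]
  rw [prism_single]
  simp [tuplePrism, coneHomotopy]

/-- Compatibility of the homotopy with faces (`map_face`) and naturality of the tuple prism allow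
the prisms over all faces of `σ` to be computed inside the one model `Δⁿ × Δ¹` of `σ`. -/
theorem SimplexHomotopy.prism_singularBoundary_single {n : ℕ}
    (σ : C(stdSimplex ℝ (Fin (n + 1)), X)) :
    h.prism k n (singularBoundary k X n (Finsupp.single σ 1)) =
      pushforward k (fun _ => affineSimplexProd) (h.toMap σ) (n + 1)
        (tuplePrism k (stdSimplex.vertex 0) (stdSimplex.vertex 1) (tupleBarycenter (Fin (n + 1))) n
          (tupleBoundary k _ n (vertexTuple k (n + 1)))) := by
  rw [singularBoundary, alternatingSum_single, tupleBoundary_single]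
  simp only [map_sum, map_smul]
  refine Finset.sum_congr rfl fun i _ => ?_
  congr 1
  rw [prism_single, ← coface_vertex, ← tupleMap_single]
  have hb : ∀ m (w : Fin (m + 1) → stdSimplex ℝ (Fin n)),
      coface i (tupleBarycenter (Fin n) m w) =
        tupleBarycenter (Fin (n + 1)) m (coface i ∘ w) := by
    rw [coface_eq_affineSimplex]
    exact affineSimplex_tupleBarycenter _
  rw [← tupleMap_tuplePrism _ _ hb]
  have hg : h.toMap (σ.comp (coface i)) =
      (h.toMap σ).comp ((coface i).prodMap (ContinuousMap.id _)) := by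
    ext1 p
    exact h.map_face σ i p
  rw [hg]
  refine pushforward_comp (a := fun _ => affineSimplexProd) _ _ (fun w => ?_) _
  ext1 t
  refine Prod.ext ?_ rfl
  change affineSimplex (coface i ∘ (Prod.fst ∘ w)) t = coface i (affineSimplex (Prod.fst ∘ w) t)
  rw [coface_eq_affineSimplex, affineSimplex_comp_apply]

theorem affineSimplex_const {ι : Type*} [Fintype ι] {m : ℕ} (q : stdSimplex ℝ ι)
    (t : stdSimplex ℝ (Fin m)) : affineSimplex (fun _ => q) t = q := by
  apply Subtype.ext
  rw [affineSimplex_coe, ← Finset.sum_smul, t.2.2, one_smul]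

theorem pushforward_tupleMap_const {n m : ℕ} (q : stdSimplex ℝ (Fin 2))
    {g : C(stdSimplex ℝ (Fin n) × stdSimplex ℝ (Fin 2), X)} {σ : C(stdSimplex ℝ (Fin n), X)}
    (hg : ∀ x, g (x, q) = σ x) (z : TupleChain k (stdSimplex ℝ (Fin n)) m) :
    pushforward k (fun _ => affineSimplexProd) g m (tupleMap k (fun y => (y, q)) m z) =
      pushSimplex σ m z := by
  let f : C(stdSimplex ℝ (Fin n), stdSimplex ℝ (Fin n) × stdSimplex ℝ (Fin 2)) :=
    (ContinuousMap.id _).prodMk (ContinuousMap.const _ q)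
  have hσ : σ = g.comp f := by
    ext1 x
    exact (hg x).symm
  have hf : ∀ w : Fin m → stdSimplex ℝ (Fin n),
      affineSimplexProd (f ∘ w) = f.comp (affineSimplex w) := fun w => by
    ext1 t
    exact Prod.ext rfl (affineSimplex_const q t)
  rw [hσ]
  exact (pushforward_comp (a := fun _ => affineSimplexProd) (a' := fun _ => affineSimplex) g f
    hf z).symm

/-- The far end of the model prism is subdivided. One formula therefore covers both uses: the
constant homotopy compares a chain with its subdivision, and the straight-line homotopy compares it
with its approximation, up to one subdivision. -/
theorem SimplexHomotopy.singularBoundary_prism {n : ℕ} (z : SingularChain k X (n + 1)) :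
    singularBoundary k X (n + 1) (h.prism k (n + 1) z) =
      z - singularSubdivision k X (n + 1) (Finsupp.lmapDomain k k h.target z) -
        h.prism k n (singularBoundary k X n z) := by
  suffices H : singularBoundary k X (n + 1) ∘ₗ h.prism k (n + 1) =
      LinearMap.id - singularSubdivision k X (n + 1) ∘ₗ Finsupp.lmapDomain k k h.target -
        h.prism k n ∘ₗ singularBoundary k X n from LinearMap.congr_fun H z
  apply Finsupp.lhom_ext'
  intro σ
  ext1
  simp only [LinearMap.comp_apply, Finsupp.lsingle_apply, LinearMap.sub_apply, LinearMap.id_apply,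
    Finsupp.lmapDomain_apply, Finsupp.mapDomain_single]
  rw [prism_singularBoundary_single, prism_single, singularBoundary_pushforward
    (fun _ w i => affineSimplexProd_removeNth w i), tupleBoundary_tuplePrism, map_sub, map_sub,
    pushforward_tupleMap_const _ (h.map_zero σ), pushforward_tupleMap_const _ (h.map_one σ),
    pushSimplex_vertexTuple, singularSubdivision_single]

theorem SimplexHomotopy.prism_mem_supported {n : ℕ} {s : Set C(stdSimplex ℝ (Fin n), X)}
    {Z : Set X} (hs : ∀ σ ∈ s, ∀ p, h.toMap σ p ∈ Z) {z : SingularChain k X n}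
    (hz : z ∈ Finsupp.supported k k s) :
    h.prism k n z ∈ Finsupp.supported k k (simplicesIn (n + 1) Z) :=
  map_mem_of_supported _ (fun σ hσ => by
    rw [prism_single]; exact pushforward_mem_supported (hs σ hσ) _) hz

/-- The constant homotopy. -/
def SimplexHomotopy.refl (X : Type*) [TopologicalSpace X] : SimplexHomotopy X where
  toMap σ := σ.comp ContinuousMap.fst
  target σ := σ
  map_zero _ _ := rfl
  map_one _ _ := rfl
  map_face _ _ _ := rfl

end Singular

end PersistenceDiagram

end

/-! ### Oriented simplices versus ordered tuples of vertices. -/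

noncomputable section

namespace PersistenceDiagram

variable {k : Type*} [Field k] {V : Type*} [LinearOrder V]

/-! ### Chains on finite vertex sets -/

/-- The augmented simplicial boundary on the span of all finite vertex sets. -/
def finsetBoundary (k : Type*) [Field k] (V : Type*) [LinearOrder V] :
    (Finset V →₀ k) →ₗ[k] (Finset V →₀ k) :=
  Finsupp.linearCombination k fun s : Finset V =>
    ∑ x ∈ s, Finsupp.single (s.erase x) ((-1 : k) ^ (s.filter (· < x)).card)

theorem finsetBoundary_single (s : Finset V) :
    finsetBoundary k V (Finsupp.single s 1) =
      ∑ x ∈ s, Finsupp.single (s.erase x) ((-1 : k) ^ (s.filter (· < x)).card) := by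
  simp [finsetBoundary]

/-- The unreduced boundary kills vertices, while the augmented one sends them to the empty simplex;
the two differ nowhere else that matters for chains. -/
theorem boundaryMap_eq_finsetBoundary {z : Finset V →₀ k}
    (hz : z ∈ Finsupp.supported k k {s : Finset V | 2 ≤ s.card}) :
    boundaryMap k z = finsetBoundary k V z := by
  rw [← sub_eq_zero, ← LinearMap.sub_apply, ← Submodule.mem_bot k]
  refine map_mem_of_supported _ (fun s (hs : 2 ≤ s.card) => ?_) hz
  simp [boundaryMap, finsetBoundary, hs]

theorem boundaryMap_eq_of_mem_chains {A : PreAbstractSimplicialComplex V} {d : ℕ}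
    {z : Finset V →₀ k} (hz : z ∈ chains k A (d + 1)) :
    boundaryMap k z = finsetBoundary k V z :=
  boundaryMap_eq_finsetBoundary (Finsupp.supported_mono (fun s hs => by
    have := hs.2
    change 2 ≤ s.card
    omega) hz)

theorem cycles_mono (k : Type*) [Field k] {A B : PreAbstractSimplicialComplex V} (h : A ≤ B) (d : ℕ) :
    cycles k A d ≤ cycles k B d :=
  inf_le_inf_right _ (Finsupp.supported_mono fun _ hs => ⟨h hs.1, hs.2⟩)

/-- Distinct vertices have distinct opposite faces, so nothing cancels. Thanks to the augmentation
this holds for a single vertex as well. -/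
theorem finsetBoundary_single_ne_zero {s : Finset V} (hs : s.Nonempty) :
    finsetBoundary k V (Finsupp.single s 1) ≠ 0 := by
  obtain ⟨x, hx⟩ := hs
  intro h
  have h' := DFunLike.congr_fun h (s.erase x)
  rw [finsetBoundary_single, Finsupp.finsetSum_apply, Finset.sum_eq_single x] at h'
  · simp at h'
  · intro y hy hyx
    rw [Finsupp.single_apply, if_neg]
    intro h
    have : x ∈ s.erase y := Finset.mem_erase.2 ⟨hyx.symm, hx⟩
    rw [h] at this
    simp at this
  · exact fun h => absurd hx h

/-- Adding a vertex to the simplices that do not contain it. -/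
def finsetCone (k : Type*) [Field k] (v : V) : (Finset V →₀ k) →ₗ[k] (Finset V →₀ k) :=
  Finsupp.linearCombination k fun s : Finset V =>
    if v ∈ s then 0 else Finsupp.single (insert v s) 1

theorem finsetCone_single (v : V) (s : Finset V) (c : k) :
    finsetCone k v (Finsupp.single s c) =
      if v ∈ s then 0 else Finsupp.single (insert v s) c := by
  by_cases h : v ∈ s <;> simp [finsetCone, h]

/-- As `v` is at most every vertex, it is inserted in first position and each other sign flips once.
If `v` is already in `s`, the cone is zero, and the only face that survives coning is the one
opposite `v`, which cones back to `s` with sign `+1`. -/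
theorem finsetBoundary_finsetCone {v : V} {z : Finset V →₀ k}
    (hz : z ∈ Finsupp.supported k k {s : Finset V | ∀ x ∈ s, v ≤ x}) :
    finsetBoundary k V (finsetCone k v z) = z - finsetCone k v (finsetBoundary k V z) := by
  suffices H : (finsetBoundary k V ∘ₗ finsetCone k v -
      (LinearMap.id - finsetCone k v ∘ₗ finsetBoundary k V) :
        (Finset V →₀ k) →ₗ[k] (Finset V →₀ k)) z ∈ (⊥ : Submodule k (Finset V →₀ k)) by
    rw [Submodule.mem_bot] at H
    exact sub_eq_zero.1 H
  refine map_mem_of_supported _ (fun s (hs : ∀ x ∈ s, v ≤ x) => ?_) hz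
  simp only [Submodule.mem_bot, LinearMap.sub_apply, LinearMap.comp_apply, LinearMap.id_apply,
    sub_eq_zero]
  rw [finsetBoundary_single, map_sum, finsetCone_single]
  simp only [finsetCone_single]
  have hlt : s.filter (· < v) = ∅ :=
    Finset.filter_eq_empty_iff.2 fun {x} hx => not_lt.2 (hs x hx)
  by_cases hv : v ∈ s
  · rw [if_pos hv, map_zero, Finset.sum_eq_single v, hlt]
    · simp [Finset.insert_erase hv]
    · intro x _ hx
      rw [if_pos (Finset.mem_erase.2 ⟨hx.symm, hv⟩)]
    · exact fun h => absurd hv h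
  · rw [if_neg hv, finsetBoundary_single, Finset.sum_insert hv, Finset.erase_insert hv,
      Finset.filter_insert, if_neg (lt_irrefl v), hlt, sub_eq_add_neg, ← Finset.sum_neg_distrib]
    congr 1
    · simp
    · refine Finset.sum_congr rfl fun x hx => ?_
      have hvx : v < x := lt_of_le_of_ne (hs x hx) fun h => hv (h ▸ hx)
      rw [if_neg fun h => hv (Finset.mem_of_mem_erase h), Finset.filter_insert, if_pos hvx,
        Finset.card_insert_of_notMem (fun h => hv (Finset.mem_filter.1 h).1), pow_succ,
        Finset.erase_insert_of_ne hvx.ne, mul_neg_one, Finsupp.single_neg]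

/-! ### Comparison with tuples -/

/-- The tuples of vertices in `S`. -/
def tuplesOver (S : Set V) (n : ℕ) : Set (Fin n → V) := {w | ∀ i, w i ∈ S}

/-- A simplex with `n` vertices, as an increasing tuple of vertices. -/
def sortedTuple (k : Type*) [Field k] (V : Type*) [LinearOrder V] (n : ℕ) :
    (Finset V →₀ k) →ₗ[k] TupleChain k V n :=
  Finsupp.linearCombination k fun s : Finset V =>
    if h : s.card = n then Finsupp.single (s.orderEmbOfFin h) 1 else 0

theorem sortedTuple_single {n : ℕ} {s : Finset V} (h : s.card = n) (c : k) :
    sortedTuple k V n (Finsupp.single s c) = Finsupp.single (s.orderEmbOfFin h : Fin n → V) c := by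
  simp [sortedTuple, h]

theorem sortedTuple_single_of_ne {n : ℕ} {s : Finset V} (h : s.card ≠ n) (c : k) :
    sortedTuple k V n (Finsupp.single s c) = 0 := by
  simp [sortedTuple, h]

theorem sortedTuple_mem_supported {n : ℕ} {S : Set V} {z : Finset V →₀ k}
    (hz : z ∈ Finsupp.supported k k {s : Finset V | (s : Set V) ⊆ S}) :
    sortedTuple k V n z ∈ Finsupp.supported k k (tuplesOver S n) := by
  refine map_mem_of_supported _ (fun s hs => ?_) hz
  have hs : (s : Set V) ⊆ S := hs
  by_cases h : s.card = n
  · rw [sortedTuple_single h]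
    exact Finsupp.single_mem_supported k _ fun i => hs (s.orderEmbOfFin_mem h i)
  · rw [sortedTuple_single_of_ne h]
    exact Submodule.zero_mem _

/-- This matches the two sign conventions: the number of smaller vertices is the position in the
sorted tuple. -/
theorem card_filter_lt_orderEmbOfFin {n : ℕ} {s : Finset V} (h : s.card = n) (i : Fin n) :
    (s.filter (· < s.orderEmbOfFin h i)).card = i := by
  have : s.filter (· < s.orderEmbOfFin h i) =
      (Finset.Iio i).map (s.orderEmbOfFin h).toEmbedding := by
    ext x
    have hx : x ∈ s ↔ ∃ j, s.orderEmbOfFin h j = x := by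
      rw [← Finset.mem_coe, ← Finset.range_orderEmbOfFin s h, Set.mem_range]
    simp only [Finset.mem_filter, Finset.mem_map, Finset.mem_Iio, hx,
      RelEmbedding.coe_toEmbedding]
    constructor
    · rintro ⟨⟨j, rfl⟩, hj⟩
      exact ⟨j, by simpa using hj, rfl⟩
    · rintro ⟨j, hj, rfl⟩
      exact ⟨⟨j, rfl⟩, by simpa using hj⟩
  rw [this, Finset.card_map, Fin.card_Iio]

theorem tupleBoundary_sortedTuple {n : ℕ} (z : Finset V →₀ k) :
    tupleBoundary k V n (sortedTuple k V (n + 1) z) =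
      sortedTuple k V n (finsetBoundary k V z) := by
  suffices H : tupleBoundary k V n ∘ₗ sortedTuple k V (n + 1) =
      sortedTuple k V n ∘ₗ finsetBoundary k V from LinearMap.congr_fun H z
  apply Finsupp.lhom_ext'
  intro s
  ext1
  simp only [LinearMap.comp_apply, Finsupp.lsingle_apply]
  rw [finsetBoundary_single, map_sum]
  by_cases h : s.card = n + 1
  · rw [sortedTuple_single h, tupleBoundary_single]
    conv_rhs => rw [← Finset.map_orderEmbOfFin_univ s h, Finset.sum_map]
    refine Finset.sum_congr rfl fun i _ => ?_
    rw [Finset.map_orderEmbOfFin_univ s h]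
    have hi : (s.erase (s.orderEmbOfFin h i)).card = n := by
      rw [Finset.card_erase_of_mem (s.orderEmbOfFin_mem h i), h]; rfl
    rw [RelEmbedding.coe_toEmbedding, sortedTuple_single hi, card_filter_lt_orderEmbOfFin,
      Finsupp.smul_single, smul_eq_mul, mul_one]
    congr 1
    refine Finset.orderEmbOfFin_unique hi (fun j => ?_) ?_
    · refine Finset.mem_erase.2 ⟨fun hj => ?_, s.orderEmbOfFin_mem h _⟩
      exact Fin.succAbove_ne i j ((s.orderEmbOfFin h).injective hj)
    · exact (s.orderEmbOfFin h).strictMono.comp (Fin.strictMono_succAbove i)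
  · rw [sortedTuple_single_of_ne h, map_zero]
    refine (Finset.sum_eq_zero fun x hx => sortedTuple_single_of_ne ?_ _).symm
    have := Finset.card_erase_add_one hx
    omega

/-- The smallest entry of a nonempty tuple. -/
def tupleMin {n : ℕ} (w : Fin (n + 1) → V) : V := Finset.univ.inf' ⟨0, Finset.mem_univ _⟩ w

theorem tupleMin_le {n : ℕ} (w : Fin (n + 1) → V) (i : Fin (n + 1)) : tupleMin w ≤ w i :=
  Finset.inf'_le _ (Finset.mem_univ i)

theorem tupleMin_mem_range {n : ℕ} (w : Fin (n + 1) → V) : tupleMin w ∈ Set.range w := by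
  obtain ⟨i, _, hi⟩ := Finset.exists_mem_eq_inf' ⟨0, Finset.mem_univ _⟩ w
  exact ⟨i, hi.symm⟩

/-- The chain map from tuples to oriented simplices. -/
def tupleToFinset (k : Type*) [Field k] (V : Type*) [LinearOrder V] :
    ∀ n, TupleChain k V n →ₗ[k] (Finset V →₀ k)
  | 0 => Finsupp.linearCombination k fun _ => Finsupp.single ∅ 1
  | n + 1 => Finsupp.linearCombination k fun w =>
      finsetCone k (tupleMin w) (tupleToFinset k V n (tupleBoundary k V n (Finsupp.single w 1)))

theorem tupleToFinset_zero_single (w : Fin 0 → V) :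
    tupleToFinset k V 0 (Finsupp.single w 1) = Finsupp.single ∅ 1 := by
  simp [tupleToFinset]

theorem tupleToFinset_succ_single {n : ℕ} (w : Fin (n + 1) → V) :
    tupleToFinset k V (n + 1) (Finsupp.single w 1) =
      finsetCone k (tupleMin w)
        (tupleToFinset k V n (tupleBoundary k V n (Finsupp.single w 1))) := by
  simp [tupleToFinset]

/-- The cardinality is part of the claim: with `S` the range of a tuple, it forces tuples with a
repeated vertex to map to zero, with no separate treatment of degenerate tuples. -/
theorem tupleToFinset_mem_supported {n : ℕ} {S : Set V} {z : TupleChain k V n}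
    (hz : z ∈ Finsupp.supported k k (tuplesOver S n)) :
    tupleToFinset k V n z ∈
      Finsupp.supported k k {s : Finset V | (s : Set V) ⊆ S ∧ s.card = n} := by
  induction n with
  | zero =>
    refine map_mem_of_supported _ (fun w _ => ?_) hz
    rw [tupleToFinset_zero_single]
    exact Finsupp.single_mem_supported k _ (by simp)
  | succ n ih =>
    refine map_mem_of_supported _ (fun w hw => ?_) hz
    rw [tupleToFinset_succ_single]
    have h := ih (tupleBoundary_mem_supported (s := tuplesOver S (n + 1)) (t := tuplesOver S n)
      (fun i w hw j => hw (i.succAbove j)) (Finsupp.single_mem_supported k (1 : k) hw))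
    refine map_mem_of_supported _ (fun s hs => ?_) h
    obtain ⟨hsS, hsn⟩ := hs
    rw [finsetCone_single]
    split_ifs with hm
    · exact Submodule.zero_mem _
    · refine Finsupp.single_mem_supported k _ ⟨?_, ?_⟩
      · rw [Finset.coe_insert, Set.insert_subset_iff]
        obtain ⟨i, hi⟩ := tupleMin_mem_range w
        exact ⟨hi ▸ hw i, hsS⟩
      · rw [Finset.card_insert_of_notMem hm, hsn]

/-- Taking the minimum of the tuple as apex makes the cone formula applicable; its correction term
vanishes by induction and `∂ ∂ = 0`. No permutation signs are needed. -/
theorem finsetBoundary_tupleToFinset {n : ℕ} (z : TupleChain k V (n + 1)) :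
    finsetBoundary k V (tupleToFinset k V (n + 1) z) =
      tupleToFinset k V n (tupleBoundary k V n z) := by
  have key : ∀ (n : ℕ) (w : Fin (n + 1) → V),
      finsetBoundary k V (tupleToFinset k V (n + 1) (Finsupp.single w 1)) =
        tupleToFinset k V n (tupleBoundary k V n (Finsupp.single w 1)) -
          finsetCone k (tupleMin w) (finsetBoundary k V
            (tupleToFinset k V n (tupleBoundary k V n (Finsupp.single w 1)))) := by
    intro n w
    rw [tupleToFinset_succ_single, finsetBoundary_finsetCone]
    have h := tupleToFinset_mem_supported (tupleBoundary_mem_supported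
      (s := tuplesOver (Set.range w) (n + 1)) (t := tuplesOver (Set.range w) n)
      (fun i w hw j => hw (i.succAbove j))
      (Finsupp.single_mem_supported k (1 : k) (show w ∈ tuplesOver (Set.range w) (n + 1) from
        fun i => ⟨i, rfl⟩)))
    refine Finsupp.supported_mono (fun s hs x hx => ?_) h
    obtain ⟨i, hi⟩ := hs.1 hx
    exact hi ▸ tupleMin_le w i
  suffices H : finsetBoundary k V ∘ₗ tupleToFinset k V (n + 1) =
      tupleToFinset k V n ∘ₗ tupleBoundary k V n from LinearMap.congr_fun H z
  induction n with
  | zero =>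
    apply Finsupp.lhom_ext'
    intro w
    ext1
    simp only [LinearMap.comp_apply, Finsupp.lsingle_apply]
    rw [key, sub_eq_self, tupleBoundary_single]
    simp [tupleToFinset_zero_single, finsetBoundary_single]
  | succ n ih =>
    apply Finsupp.lhom_ext'
    intro w
    ext1
    simp only [LinearMap.comp_apply, Finsupp.lsingle_apply]
    rw [key, ← LinearMap.comp_apply (finsetBoundary k V), ih (tupleBoundary k V (n + 1)
      (Finsupp.single w 1)), LinearMap.comp_apply, tupleBoundary_tupleBoundary, map_zero, map_zero,
      sub_zero]

/-- The chain homotopy between the identity of tuples and sorting of tuples. -/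
def sortHomotopy (k : Type*) [Field k] (V : Type*) [LinearOrder V] :
    ∀ n, TupleChain k V n →ₗ[k] TupleChain k V (n + 1) :=
  coneHomotopy (fun n => LinearMap.id - sortedTuple k V n ∘ₗ tupleToFinset k V n) fun _ w => w 0

theorem sortHomotopy_zero : sortHomotopy k V 0 = 0 := rfl

theorem tupleBoundary_sortHomotopy {n : ℕ} (z : TupleChain k V (n + 1)) :
    tupleBoundary k V (n + 1) (sortHomotopy k V (n + 1) z) =
      z - sortedTuple k V (n + 1) (tupleToFinset k V (n + 1) z) -
        sortHomotopy k V n (tupleBoundary k V n z) := by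
  refine tupleBoundary_coneHomotopy _ ?_ (fun n z => ?_) n z
  · apply Finsupp.lhom_ext'
    intro w
    ext1
    simp only [LinearMap.comp_apply, Finsupp.lsingle_apply, LinearMap.sub_apply,
      LinearMap.id_apply, LinearMap.zero_apply]
    rw [tupleToFinset_zero_single, sortedTuple_single Finset.card_empty, sub_eq_zero]
    congr 1
    exact Subsingleton.elim _ _
  · simp only [LinearMap.sub_apply, LinearMap.comp_apply, LinearMap.id_apply, map_sub,
      tupleBoundary_sortedTuple, finsetBoundary_tupleToFinset]

theorem sortHomotopy_mem_supported {n : ℕ} {S : Set V} {z : TupleChain k V n}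
    (hz : z ∈ Finsupp.supported k k (tuplesOver S n)) :
    sortHomotopy k V n z ∈ Finsupp.supported k k (tuplesOver S (n + 1)) := by
  induction n with
  | zero =>
    rw [sortHomotopy_zero]
    exact Submodule.zero_mem _
  | succ n ih =>
    refine map_mem_of_supported _ (fun w hw => ?_) hz
    have hw' := Finsupp.single_mem_supported k (1 : k) hw
    rw [sortHomotopy, coneHomotopy_succ_single]
    refine tupleCone_mem_supported (s := tuplesOver S (n + 1)) (t := tuplesOver S (n + 2))
      (fun u hu i => ?_) (Submodule.sub_mem _ (Submodule.sub_mem _ hw' ?_) (ih ?_))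
    · exact Fin.cases (hw 0) hu i
    · exact sortedTuple_mem_supported
        (Finsupp.supported_mono (fun s hs => hs.1) (tupleToFinset_mem_supported hw'))
    · exact tupleBoundary_mem_supported (s := tuplesOver S (n + 1)) (t := tuplesOver S n)
        (fun i w hw j => hw (i.succAbove j)) hw'

/-- The tuples of vertices that lie in a common simplex of `A`. -/
def tuplesIn (A : PreAbstractSimplicialComplex V) (n : ℕ) : Set (Fin n → V) :=
  {w | ∃ s ∈ A, w ∈ tuplesOver (s : Set V) n}

theorem sortHomotopy_mem_supported_tuplesIn {A : PreAbstractSimplicialComplex V}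
    {n : ℕ} {z : TupleChain k V n} (hz : z ∈ Finsupp.supported k k (tuplesIn A n)) :
    sortHomotopy k V n z ∈ Finsupp.supported k k (tuplesIn A (n + 1)) := by
  refine map_mem_of_supported _ (fun w hw => ?_) hz
  obtain ⟨s, hs, hw⟩ := hw
  exact Finsupp.supported_mono (s := tuplesOver (s : Set V) (n + 1)) (t := tuplesIn A (n + 1))
    (fun _ hu => ⟨s, hs, hu⟩) (sortHomotopy_mem_supported (Finsupp.single_mem_supported k (1 : k) hw))

theorem tupleToFinset_mem_chains {A : PreAbstractSimplicialComplex V}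
    {n : ℕ} {z : TupleChain k V (n + 1)} (hz : z ∈ Finsupp.supported k k (tuplesIn A (n + 1))) :
    tupleToFinset k V (n + 1) z ∈ chains k A n := by
  refine map_mem_of_supported _ (fun w hw => ?_) hz
  obtain ⟨s, hs, hw⟩ := hw
  refine Finsupp.supported_mono (t := {t | t ∈ A ∧ t.card = n + 1}) (fun t ht => ⟨?_, ht.2⟩)
    (tupleToFinset_mem_supported (Finsupp.single_mem_supported k (1 : k) hw))
  exact (A.isRelLowerSet_faces hs).2 (Finset.coe_subset.1 ht.1)
    (Finset.card_pos.1 (by rw [ht.2]; omega))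

/-- An augmentation-preserving chain endomorphism that maps each simplex to chains on that simplex
is the identity. -/
theorem eq_single_of_carried {f : ℕ → (Finset V →₀ k) →ₗ[k] (Finset V →₀ k)}
    (hf0 : f 0 (Finsupp.single ∅ 1) = Finsupp.single ∅ 1)
    (hf : ∀ n z, finsetBoundary k V (f (n + 1) z) = f n (finsetBoundary k V z))
    (hs : ∀ (s : Finset V), f s.card (Finsupp.single s 1) ∈
      Finsupp.supported k k {t : Finset V | t ⊆ s ∧ t.card = s.card})
    {n : ℕ} {s : Finset V} (hn : s.card = n) :
    f n (Finsupp.single s 1) = Finsupp.single s 1 := by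
  induction n generalizing s with
  | zero => rw [Finset.card_eq_zero.1 hn, hf0]
  | succ n ih =>
    have h := hs s
    have hset : {t : Finset V | t ⊆ s ∧ t.card = s.card} = {s} := by
      ext t
      constructor
      · rintro ⟨h₁, h₂⟩
        exact Finset.eq_of_subset_of_card_le h₁ h₂.ge
      · rintro rfl
        exact ⟨subset_rfl, rfl⟩
    rw [hset, hn, Finsupp.supported_eq_span_single, Set.image_singleton,
      Submodule.mem_span_singleton] at h
    obtain ⟨c, hc⟩ := h
    -- The image of `s` is a multiple `c • s`. Comparing boundaries by induction gives `(c - 1) • ∂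
    -- s = 0`, and `∂ s ≠ 0`.
    have hb : finsetBoundary k V (f (n + 1) (Finsupp.single s 1)) =
        finsetBoundary k V (Finsupp.single s 1) := by
      rw [hf, finsetBoundary_single, map_sum]
      refine Finset.sum_congr rfl fun x hx => ?_
      have hx' : (s.erase x).card = n := by
        have := Finset.card_erase_add_one hx
        omega
      rw [← Finsupp.smul_single_one, map_smul, ih hx']
    rw [← hc, map_smul, ← sub_eq_zero, ← one_smul k (finsetBoundary k V (Finsupp.single s 1)),
      smul_smul, ← sub_smul, mul_one, smul_eq_zero] at hb
    rcases hb with hb | hb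
    · rw [← hc, sub_eq_zero.1 hb, one_smul]
    · exact absurd hb (finsetBoundary_single_ne_zero (Finset.card_pos.1 (by omega)))

end PersistenceDiagram

end

/-! ### Mesh of iterated subdivisions and simplicial approximation. -/

noncomputable section

namespace PersistenceDiagram

variable {k : Type*} [Field k]

/-! ### Subdivision shrinks simplices -/

section Mesh

variable {ι : Type*} [Fintype ι]

theorem dist_affineSimplex_le {m : ℕ} {w : Fin m → stdSimplex ℝ ι} {x : stdSimplex ℝ ι} {c : ℝ}
    (h : ∀ j, dist (w j) x ≤ c) (t : stdSimplex ℝ (Fin m)) : dist (affineSimplex w t) x ≤ c :=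
  (convex_closedBall x.1 c).sum_mem (fun j _ => t.2.1 j) t.2.2 fun j _ => h j

/-- The difference is the average of the `w j - w i`; the term `i = j` vanishes, leaving `n` terms
out of `n + 1`. -/
theorem dist_tupleBarycenter_le {n : ℕ} {w : Fin (n + 1) → stdSimplex ℝ ι} {D : ℝ}
    (h : ∀ i j, dist (w i) (w j) ≤ D) (j : Fin (n + 1)) :
    dist (w j) (tupleBarycenter ι n w) ≤ (1 - 1 / ((n : ℝ) + 1)) * D := by
  have hn : (0 : ℝ) < (n : ℝ) + 1 := by positivity
  have hb : (tupleBarycenter ι n w).1 = ∑ i, ((n : ℝ) + 1)⁻¹ • (w i).1 := by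
    simp [tupleBarycenter, affineSimplex_coe]
  have hj : (w j).1 = ∑ _i : Fin (n + 1), ((n : ℝ) + 1)⁻¹ • (w j).1 := by
    rw [Finset.sum_const, Finset.card_univ, Fintype.card_fin, ← Nat.cast_smul_eq_nsmul ℝ,
      smul_smul, Nat.cast_add, Nat.cast_one, mul_inv_cancel₀ hn.ne', one_smul]
  rw [Subtype.dist_eq, dist_eq_norm, hb]
  nth_rewrite 1 [hj]
  rw [← Finset.sum_sub_distrib]
  refine (norm_sum_le _ _).trans ?_
  have hi : ∀ i, ‖((n : ℝ) + 1)⁻¹ • (w j).1 - ((n : ℝ) + 1)⁻¹ • (w i).1‖ ≤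
      if i = j then 0 else ((n : ℝ) + 1)⁻¹ * D := by
    intro i
    rw [← smul_sub, norm_smul, Real.norm_of_nonneg (by positivity)]
    split_ifs with hij
    · simp [hij]
    · exact mul_le_mul_of_nonneg_left (by rw [← dist_eq_norm]; exact h j i) (by positivity)
  refine (Finset.sum_le_sum fun i _ => hi i).trans (le_of_eq ?_)
  rw [Finset.sum_ite, Finset.sum_const_zero, zero_add, Finset.sum_const,
    Finset.filter_ne' Finset.univ j, Finset.card_erase_of_mem (Finset.mem_univ j), Finset.card_univ,
    Fintype.card_fin, nsmul_eq_mul]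
  push_cast [Nat.add_sub_cancel]
  field_simp
  ring

/-- The tuples of points at mutual distance at most `D`. -/
def tuplesOfDiam (ι : Type*) [Fintype ι] (n : ℕ) (D : ℝ) : Set (Fin n → stdSimplex ℝ ι) :=
  {w | ∀ i j, dist (w i) (w j) ≤ D}

/-- The tuples of diameter at most `D` that stay in every ball containing the tuple `w`. -/
def tuplesInHull {m : ℕ} (w : Fin m → stdSimplex ℝ ι) (n : ℕ) (D : ℝ) :
    Set (Fin n → stdSimplex ℝ ι) :=
  {u | u ∈ tuplesOfDiam ι n D ∧ ∀ x c, (∀ j, dist (w j) x ≤ c) → ∀ i, dist (u i) x ≤ c}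

/-- The ball condition carries the induction: a ball around the barycenter containing `w` also
contains the pieces of its faces, which bounds the distances to the new apex. Faces have fewer
vertices and contract at least as fast, so one factor with a fixed `M` serves all of them. -/
theorem tupleSubdivision_single_mem_supported {M m : ℕ} (hm : m ≤ M)
    {w : Fin m → stdSimplex ℝ ι} {D : ℝ} (hw : w ∈ tuplesOfDiam ι m D) :
    tupleSubdivision k (tupleBarycenter ι) m (Finsupp.single w 1) ∈
      Finsupp.supported k k (tuplesInHull w m ((1 - 1 / (M : ℝ)) * D)) := by
  induction m with
  | zero =>
    exact Finsupp.single_mem_supported k _ ⟨fun i => i.elim0, fun _ _ _ i => i.elim0⟩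
  | succ m ih =>
    have hM : (0 : ℝ) < (m : ℝ) + 1 := by positivity
    have hM' : (m : ℝ) + 1 ≤ M := by exact_mod_cast hm
    have hD : 0 ≤ D := dist_nonneg.trans (hw 0 0)
    have hθ : (1 - 1 / ((m : ℝ) + 1)) * D ≤ (1 - 1 / (M : ℝ)) * D :=
      mul_le_mul_of_nonneg_right (sub_le_sub_left (one_div_le_one_div_of_le hM hM') _) hD
    have hθ0 : 0 ≤ (1 - 1 / (M : ℝ)) * D := by
      refine mul_nonneg (sub_nonneg.2 ?_) hD
      rw [div_le_one (hM.trans_le hM')]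
      linarith [(Nat.cast_nonneg m : (0 : ℝ) ≤ m)]
    have hb : ∀ j, dist (w j) (tupleBarycenter ι m w) ≤ (1 - 1 / (M : ℝ)) * D := fun j =>
      (dist_tupleBarycenter_le hw j).trans hθ
    rw [tupleSubdivision_succ_single]
    refine tupleCone_mem_supported (s := tuplesInHull w m ((1 - 1 / (M : ℝ)) * D))
      (t := tuplesInHull w (m + 1) ((1 - 1 / (M : ℝ)) * D)) (fun u hu => ⟨?_, ?_⟩) ?_
    · have hbu : ∀ i, dist (u i) (tupleBarycenter ι m w) ≤ (1 - 1 / (M : ℝ)) * D :=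
        hu.2 _ _ hb
      intro i j
      refine Fin.cases ?_ (fun i => ?_) i <;> refine Fin.cases ?_ (fun j => ?_) j
      · simpa using hθ0
      · simpa [dist_comm] using hbu j
      · simpa using hbu i
      · simpa using hu.1 i j
    · intro x c hx i
      refine Fin.cases ?_ (fun i => ?_) i
      · exact dist_affineSimplex_le hx _
      · exact hu.2 x c hx i
    · rw [tupleBoundary_single, map_sum]
      refine Submodule.sum_mem _ fun i _ => ?_
      rw [map_smul]
      refine Submodule.smul_mem _ _ (Finsupp.supported_mono ?_ (ih (by omega)
        (w := i.removeNth w) (fun a b => hw _ _)))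
      exact fun u hu => ⟨hu.1, fun x c hx => hu.2 x c fun j => hx _⟩

theorem tupleSubdivision_pow_mem_supported (n N : ℕ) :
    (tupleSubdivision k (tupleBarycenter (Fin n)) n ^ N) (vertexTuple k n) ∈
      Finsupp.supported k k (tuplesOfDiam (Fin n) n ((1 - 1 / ((n : ℝ) + 1)) ^ N)) := by
  induction N with
  | zero =>
    refine Finsupp.single_mem_supported k _ fun i j => ?_
    rw [pow_zero, Subtype.dist_eq]
    exact (Metric.dist_le_diam_of_mem (bounded_stdSimplex _) (Subtype.mem _)
      (Subtype.mem _)).trans diam_stdSimplex_le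
  | succ N ih =>
    rw [pow_succ' (tupleSubdivision k (tupleBarycenter (Fin n)) n), Module.End.mul_apply]
    refine map_mem_of_supported _ (fun w hw => ?_) ih
    -- Taking `M = n + 1` rather than `n` keeps the factor below `1` even for `n = 0`.
    refine Finsupp.supported_mono (fun u hu => ?_)
      (tupleSubdivision_single_mem_supported (M := n + 1) (Nat.le_succ n) hw)
    have := hu.1
    rwa [Nat.cast_add, Nat.cast_one, ← pow_succ'] at this

theorem singularSubdivision_pow_single {X : Type*} [TopologicalSpace X] {n : ℕ}
    (σ : C(stdSimplex ℝ (Fin n), X)) (N : ℕ) :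
    (singularSubdivision k X n ^ N) (Finsupp.single σ 1) =
      pushSimplex σ n
        ((tupleSubdivision k (tupleBarycenter (Fin n)) n ^ N) (vertexTuple k n)) := by
  induction N with
  | zero => simp only [pow_zero, Module.End.one_apply, pushSimplex_vertexTuple]
  | succ N ih =>
    rw [pow_succ', pow_succ', Module.End.mul_apply, Module.End.mul_apply, ih,
      singularSubdivision_pushSimplex]

end Mesh

theorem singularBoundary_singularSubdivision_pow {X : Type*} [TopologicalSpace X] {n : ℕ} (N : ℕ)
    (z : SingularChain k X (n + 1)) :
    singularBoundary k X n ((singularSubdivision k X (n + 1) ^ N) z) =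
      (singularSubdivision k X n ^ N) (singularBoundary k X n z) := by
  induction N with
  | zero => rfl
  | succ N ih =>
    rw [pow_succ', pow_succ', Module.End.mul_apply, Module.End.mul_apply,
      singularBoundary_singularSubdivision, ih]

theorem singularSubdivision_pow_mem_supported {X : Type*} [TopologicalSpace X] {n : ℕ} (N : ℕ)
    {Z : Set X} {z : SingularChain k X n}
    (hz : z ∈ Finsupp.supported k k (simplicesIn n Z)) :
    (singularSubdivision k X n ^ N) z ∈ Finsupp.supported k k (simplicesIn n Z) := by
  induction N with
  | zero => exact hz
  | succ N ih =>
    rw [pow_succ', Module.End.mul_apply]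
    exact singularSubdivision_mem_supported ih

theorem singularSubdivision_zero (X : Type*) [TopologicalSpace X] :
    singularSubdivision k X 0 = LinearMap.id := by
  apply Finsupp.lhom_ext'
  intro σ
  ext1
  simp only [LinearMap.comp_apply, Finsupp.lsingle_apply, LinearMap.id_apply]
  rw [singularSubdivision_single]
  exact pushSimplex_vertexTuple σ

/-! ### Simplices of the underlying space -/

section Realization

variable {V : Type u} [Fintype V]

/-- The closed simplex spanned by a set of vertices. -/
def faceSet (s : Set V) : Set (V → ℝ) := {x | x ∈ stdSimplex ℝ V ∧ Function.support x ⊆ s}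

theorem mem_realizationSet {A : PreAbstractSimplicialComplex V} {x : V → ℝ} :
    x ∈ realizationSet A ↔ ∃ s ∈ A, x ∈ faceSet (s : Set V) :=
  ⟨fun ⟨hx, s, hs, h⟩ => ⟨s, hs, hx, h⟩, fun ⟨s, hs, hx, h⟩ => ⟨hx, s, hs, h⟩⟩

theorem simplicesIn_faceSet_subset {A : PreAbstractSimplicialComplex V} {s : Finset V}
    (hs : s ∈ A) (n : ℕ) :
    simplicesIn n (faceSet (s : Set V)) ⊆ simplicesIn n (realizationSet A) :=
  fun _ hσ t => mem_realizationSet.2 ⟨s, hs, hσ t⟩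

/-- The singular chains in the underlying space of `A`. -/
abbrev chainsIn (k : Type*) [Field k] (A : PreAbstractSimplicialComplex V) (n : ℕ) :
    Submodule k (SingularChain k (V → ℝ) n) :=
  Finsupp.supported k k (simplicesIn n (realizationSet A))

theorem convex_faceSet (s : Set V) : Convex ℝ (faceSet s) := by
  intro x hx y hy a b ha hb hab
  refine ⟨convex_stdSimplex ℝ V hx.1 hy.1 ha hb hab, fun v hv => ?_⟩
  by_contra hvs
  have hxv : x v = 0 := by
    by_contra h
    exact hvs (hx.2 h)
  have hyv : y v = 0 := by
    by_contra h
    exact hvs (hy.2 h)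
  exact hv (by simp [hxv, hyv])

section MainVertex

variable [Nonempty V]

/-- A vertex at which a function is maximal. -/
def mainVertex (x : V → ℝ) : V := (Finite.exists_max x).choose

theorem le_mainVertex (x : V → ℝ) (v : V) : x v ≤ x (mainVertex x) :=
  (Finite.exists_max x).choose_spec v

theorem inv_card_le_mainVertex {x : V → ℝ} (hx : x ∈ stdSimplex ℝ V) :
    (Fintype.card V : ℝ)⁻¹ ≤ x (mainVertex x) := by
  have h : (1 : ℝ) ≤ Fintype.card V * x (mainVertex x) := by
    rw [← hx.2, ← nsmul_eq_mul, ← Finset.card_univ]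
    exact Finset.sum_le_card_nsmul _ _ _ fun v _ => le_mainVertex x v
  have hV : (0 : ℝ) < Fintype.card V := by exact_mod_cast Fintype.card_pos
  rwa [inv_le_iff_one_le_mul₀' hV]

theorem mainVertex_pos {x : V → ℝ} (hx : x ∈ stdSimplex ℝ V) : 0 < x (mainVertex x) :=
  (inv_pos.2 (by exact_mod_cast Fintype.card_pos)).trans_le (inv_card_le_mainVertex hx)

/-- The tuple of the main vertices of the corners of a singular simplex. -/
def mainTuple {n : ℕ} (σ : C(stdSimplex ℝ (Fin n), V → ℝ)) (i : Fin n) : V :=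
  mainVertex (σ (stdSimplex.vertex i))

theorem mainTuple_comp_coface {n : ℕ} (σ : C(stdSimplex ℝ (Fin (n + 1)), V → ℝ))
    (i : Fin (n + 1)) : mainTuple (σ.comp (coface i)) = i.removeNth (mainTuple σ) := by
  funext j
  change mainVertex (σ ((coface i ∘ stdSimplex.vertex (S := ℝ)) j)) = _
  rw [coface_vertex]
  rfl

/-- The simplicial approximation of singular chains by tuples of vertices. -/
def singularToTuple (k : Type*) [Field k] (V : Type u) [Fintype V] [Nonempty V]
    (n : ℕ) : SingularChain k (V → ℝ) n →ₗ[k] TupleChain k V n :=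
  Finsupp.lmapDomain k k mainTuple

theorem tupleBoundary_singularToTuple {n : ℕ} (z : SingularChain k (V → ℝ) (n + 1)) :
    tupleBoundary k V n (singularToTuple k V (n + 1) z) =
      singularToTuple k V n (singularBoundary k (V → ℝ) n z) := by
  unfold singularBoundary singularToTuple tupleBoundary
  exact (lmapDomain_alternatingSum (fun i σ => mainTuple_comp_coface σ i) z).symm

/-- A main vertex has positive coordinate, hence belongs to every closed face containing the point.
No smallness is needed here, so the carrier argument works for every number of subdivisions. -/
theorem singularToTuple_mem_supported {n : ℕ} {s : Set V} {z : SingularChain k (V → ℝ) n}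
    (hz : z ∈ Finsupp.supported k k (simplicesIn n (faceSet s))) :
    singularToTuple k V n z ∈ Finsupp.supported k k (tuplesOver s n) :=
  lmapDomain_mem_supported (s := simplicesIn n (faceSet s)) (t := tuplesOver s n)
    (fun _ hσ _ => (hσ _).2 (mainVertex_pos (hσ _).1).ne') hz

/-- The singular simplices in `A` all of whose points have positive coordinates at the main
vertices of the corners. -/
def smallSimplices (A : PreAbstractSimplicialComplex V) (n : ℕ) :
    Set C(stdSimplex ℝ (Fin n), V → ℝ) :=
  {σ | ∀ t, σ t ∈ realizationSet A ∧ ∀ i, 0 < σ t (mainTuple σ i)}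

/-- A single point suffices: it lies in a closed simplex of `A`, and all main vertices have positive
coordinate there, so all of them are vertices of that simplex. -/
theorem singularToTuple_mem_supported_tuplesIn {A : PreAbstractSimplicialComplex V} {n : ℕ}
    {z : SingularChain k (V → ℝ) (n + 1)}
    (hz : z ∈ Finsupp.supported k k (smallSimplices A (n + 1))) :
    singularToTuple k V (n + 1) z ∈ Finsupp.supported k k (tuplesIn A (n + 1)) := by
  refine lmapDomain_mem_supported (s := smallSimplices A (n + 1)) (t := tuplesIn A (n + 1))
    (fun σ hσ => ?_) hz
  obtain ⟨h₁, h₂⟩ := hσ (stdSimplex.vertex 0)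
  obtain ⟨s, hs, hx⟩ := mem_realizationSet.1 h₁
  exact ⟨s, hs, fun i => hx.2 (h₂ i).ne'⟩

/-- A main vertex has coordinate at least `1 / card V`. By uniform continuity, pieces of small
diameter change every coordinate by less than that, so the coordinate stays positive. The claim for
all `N ≥ N₀` lets a maximum over the support of a chain be taken. -/
theorem exists_singularSubdivision_pow_single_mem {A : PreAbstractSimplicialComplex V} {n : ℕ}
    {σ : C(stdSimplex ℝ (Fin n), V → ℝ)} (hσ : σ ∈ simplicesIn n (realizationSet A)) :
    ∃ N₀, ∀ N ≥ N₀, (singularSubdivision k (V → ℝ) n ^ N) (Finsupp.single σ 1) ∈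
      Finsupp.supported k k (smallSimplices A n) := by
  have hV : (0 : ℝ) < (Fintype.card V : ℝ)⁻¹ := inv_pos.2 (by exact_mod_cast Fintype.card_pos)
  have hn : (0 : ℝ) < (n : ℝ) + 1 := by positivity
  have hn1 : 1 / ((n : ℝ) + 1) ≤ 1 := by
    rw [div_le_one hn]
    linarith [(Nat.cast_nonneg n : (0 : ℝ) ≤ n)]
  have hθ0 : 0 ≤ 1 - 1 / ((n : ℝ) + 1) := sub_nonneg.2 hn1
  have hθ1 : 1 - 1 / ((n : ℝ) + 1) < 1 := by
    have : 0 < 1 / ((n : ℝ) + 1) := by positivity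
    linarith
  obtain ⟨δ, hδ, hσδ⟩ := Metric.uniformContinuous_iff.1
    (CompactSpace.uniformContinuous_of_continuous σ.continuous) _ hV
  obtain ⟨N₀, hN₀⟩ := exists_pow_lt_of_lt_one hδ hθ1
  refine ⟨N₀, fun N hN => ?_⟩
  rw [singularSubdivision_pow_single]
  refine map_mem_of_supported _ (fun w hw => ?_) (tupleSubdivision_pow_mem_supported n N)
  rw [pushforward_single]
  refine Finsupp.single_mem_supported k _ fun t => ⟨hσ _, fun i => ?_⟩
  have hwi : affineSimplex w (stdSimplex.vertex i) = w i :=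
    congrFun (affineSimplex_vertex_comp w id) i
  have hd : dist (affineSimplex w t) (w i) < δ :=
    (dist_affineSimplex_le (fun j => hw j i) t).trans_lt
      ((pow_le_pow_of_le_one hθ0 hθ1.le hN).trans_lt hN₀)
  have hmain : mainTuple (σ.comp (affineSimplex w)) i = mainVertex (σ (w i)) := by
    rw [mainTuple, ContinuousMap.comp_apply, hwi]
  rw [hmain, ContinuousMap.comp_apply]
  have h₁ := (dist_le_pi_dist (σ (affineSimplex w t)) (σ (w i)) (mainVertex (σ (w i)))).trans_lt
    (hσδ hd)
  have h₂ := inv_card_le_mainVertex (hσ (w i)).1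
  rw [Real.dist_eq] at h₁
  linarith [(abs_lt.1 h₁).1]

theorem exists_singularSubdivision_pow_mem {A : PreAbstractSimplicialComplex V} {n : ℕ}
    {z : SingularChain k (V → ℝ) n}
    (hz : z ∈ Finsupp.supported k k (simplicesIn n (realizationSet A))) :
    ∃ N, (singularSubdivision k (V → ℝ) n ^ N) z ∈
      Finsupp.supported k k (smallSimplices A n) := by
  have h : ∀ σ : C(stdSimplex ℝ (Fin n), V → ℝ), ∃ N₀, σ ∈ z.support → ∀ N ≥ N₀,
      (singularSubdivision k (V → ℝ) n ^ N) (Finsupp.single σ 1) ∈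
        Finsupp.supported k k (smallSimplices A n) := by
    intro σ
    by_cases hσ : σ ∈ z.support
    · obtain ⟨N₀, hN₀⟩ := exists_singularSubdivision_pow_single_mem (k := k)
        ((Finsupp.mem_supported k z).1 hz hσ)
      exact ⟨N₀, fun _ => hN₀⟩
    · exact ⟨0, fun h => absurd h hσ⟩
  choose N hN using h
  refine ⟨z.support.sup N, map_mem_of_supported (s := (z.support : Set _)) _ (fun σ hσ => ?_)
    ((Finsupp.mem_supported k z).2 subset_rfl)⟩
  exact hN σ hσ _ (Finset.le_sup hσ)

end MainVertex

variable [DecidableEq V]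

/-- The affine simplex in `V → ℝ` spanned by a tuple of vertices. -/
def simplexOfTuple {n : ℕ} (w : Fin n → V) : C(stdSimplex ℝ (Fin n), V → ℝ) :=
  (⟨Subtype.val, continuous_subtype_val⟩ : C(stdSimplex ℝ V, V → ℝ)).comp
    (affineSimplex (stdSimplex.vertex (S := ℝ) ∘ w))

theorem simplexOfTuple_removeNth {n : ℕ} (w : Fin (n + 1) → V) (i : Fin (n + 1)) :
    simplexOfTuple (i.removeNth w) = (simplexOfTuple w).comp (coface i) := by
  rw [simplexOfTuple, simplexOfTuple, ContinuousMap.comp_assoc, ← affineSimplex_removeNth]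
  rfl

theorem simplexOfTuple_mem_faceSet {n : ℕ} {w : Fin n → V} {s : Set V} (hw : w ∈ tuplesOver s n)
    (t : stdSimplex ℝ (Fin n)) : simplexOfTuple w t ∈ faceSet s := by
  refine (convex_faceSet s).sum_mem (fun j _ => t.2.1 j) t.2.2 fun j _ => ⟨Subtype.mem _, ?_⟩
  intro v hv
  have : v = w j := by
    by_contra h
    exact hv (by simp [h])
  exact this ▸ hw j

/-- The affine singular chain of a chain of tuples of vertices. -/
def tupleToSingular (k : Type*) [Field k] (V : Type u) [Fintype V] [DecidableEq V] (n : ℕ) :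
    TupleChain k V n →ₗ[k] SingularChain k (V → ℝ) n :=
  Finsupp.lmapDomain k k simplexOfTuple

theorem singularBoundary_tupleToSingular {n : ℕ} (z : TupleChain k V (n + 1)) :
    singularBoundary k (V → ℝ) n (tupleToSingular k V (n + 1) z) =
      tupleToSingular k V n (tupleBoundary k V n z) := by
  unfold singularBoundary tupleToSingular tupleBoundary
  exact (lmapDomain_alternatingSum (fun i w => simplexOfTuple_removeNth w i) z).symm

theorem tupleToSingular_mem_supported {n : ℕ} {s : Set V} {z : TupleChain k V n}
    (hz : z ∈ Finsupp.supported k k (tuplesOver s n)) :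
    tupleToSingular k V n z ∈ Finsupp.supported k k (simplicesIn n (faceSet s)) :=
  lmapDomain_mem_supported (s := tuplesOver s n) (t := simplicesIn n (faceSet s))
    (fun _ hw t => simplexOfTuple_mem_faceSet hw t) hz

variable [Nonempty V]

/-- The straight-line homotopy to the simplicial approximation. -/
def approximationHomotopy (V : Type u) [Fintype V] [DecidableEq V] [Nonempty V] :
    SimplexHomotopy (V → ℝ) where
  toMap σ := ⟨fun p => p.2.1 0 • σ p.1 + p.2.1 1 • simplexOfTuple (mainTuple σ) p.1, by
    have h : ∀ i : Fin 2, Continuous fun y : stdSimplex ℝ (Fin 2) => y.1 i := fun i =>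
      (continuous_apply i).comp continuous_subtype_val
    exact (((h 0).comp continuous_snd).smul (σ.continuous.comp continuous_fst)).add
      (((h 1).comp continuous_snd).smul
        ((simplexOfTuple (mainTuple σ)).continuous.comp continuous_fst))⟩
  target σ := simplexOfTuple (mainTuple σ)
  map_zero σ x := by simp
  map_one σ x := by simp
  map_face σ i p := by
    simp only [ContinuousMap.coe_mk, mainTuple_comp_coface, simplexOfTuple_removeNth]
    rfl

theorem lmapDomain_approximationHomotopy_target {n : ℕ} (z : SingularChain k (V → ℝ) n) :
    Finsupp.lmapDomain k k (approximationHomotopy V).target z =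
      tupleToSingular k V n (singularToTuple k V n z) := by
  simp only [tupleToSingular, singularToTuple, Finsupp.lmapDomain_apply, ← Finsupp.mapDomain_comp]
  rfl

/-- At each parameter the segment joins two points of the same closed simplex of `A`, which is
convex. -/
theorem approximationHomotopy_mem_realizationSet {A : PreAbstractSimplicialComplex V} {n : ℕ}
    {σ : C(stdSimplex ℝ (Fin n), V → ℝ)} (hσ : σ ∈ smallSimplices A n)
    (p : stdSimplex ℝ (Fin n) × stdSimplex ℝ (Fin 2)) :
    (approximationHomotopy V).toMap σ p ∈ realizationSet A := by
  obtain ⟨h₁, h₂⟩ := hσ p.1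
  obtain ⟨s, hs, hx⟩ := mem_realizationSet.1 h₁
  refine mem_realizationSet.2 ⟨s, hs, convex_faceSet _ hx ?_ (p.2.2.1 0) (p.2.2.1 1)
    (stdSimplex.add_eq_one p.2)⟩
  exact simplexOfTuple_mem_faceSet (fun i => hx.2 (h₂ i).ne') _

end Realization

end PersistenceDiagram

end

/-! ### Simplicial cycles and boundaries versus singular ones. -/

noncomputable section

namespace PersistenceDiagram

variable {k : Type*} [Field k]

/-! ### Simplicial and singular chains of a complex -/

theorem eq_zero_of_mem_chains {V : Type*} [IsEmpty V] {A : PreAbstractSimplicialComplex V} {d : ℕ}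
    {z : Finset V →₀ k} (hz : z ∈ chains k A d) : z = 0 := by
  rw [← Submodule.mem_bot k]
  refine map_mem_of_supported LinearMap.id (fun s hs => ?_) hz
  have := hs.2
  simp [Finset.eq_empty_of_isEmpty s] at this

section Comparison

variable {V : Type u} [Fintype V] [LinearOrder V]

/-- The singular chain of a simplicial chain with `n` vertices per simplex. -/
def simplicialToSingular (k : Type*) [Field k] (V : Type u) [Fintype V] [LinearOrder V] (n : ℕ) :
    (Finset V →₀ k) →ₗ[k] SingularChain k (V → ℝ) n :=
  tupleToSingular k V n ∘ₗ sortedTuple k V n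

theorem singularBoundary_simplicialToSingular {n : ℕ} (z : Finset V →₀ k) :
    singularBoundary k (V → ℝ) n (simplicialToSingular k V (n + 1) z) =
      simplicialToSingular k V n (finsetBoundary k V z) := by
  simp only [simplicialToSingular, LinearMap.comp_apply, singularBoundary_tupleToSingular,
    tupleBoundary_sortedTuple]

theorem simplicialToSingular_single_mem (s : Finset V) (n : ℕ) :
    simplicialToSingular k V n (Finsupp.single s 1) ∈
      Finsupp.supported k k (simplicesIn n (faceSet (s : Set V))) :=
  tupleToSingular_mem_supported (sortedTuple_mem_supported
    (Finsupp.single_mem_supported k _ (subset_refl (s : Set V))))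

theorem simplicialToSingular_mem_chainsIn {A : PreAbstractSimplicialComplex V} {d : ℕ}
    {z : Finset V →₀ k} (hz : z ∈ chains k A d) (n : ℕ) :
    simplicialToSingular k V n z ∈ chainsIn k A n :=
  map_mem_of_supported _ (fun s hs => Finsupp.supported_mono
    (simplicesIn_faceSet_subset hs.1 n) (simplicialToSingular_single_mem s n)) hz

theorem tupleToSingular_mem_chainsIn [Nonempty V] {A : PreAbstractSimplicialComplex V} {n : ℕ}
    {z : TupleChain k V n} (hz : z ∈ Finsupp.supported k k (tuplesIn A n)) :
    tupleToSingular k V n z ∈ chainsIn k A n := by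
  refine map_mem_of_supported _ (fun w hw => ?_) hz
  obtain ⟨s, hs, hw⟩ := hw
  exact Finsupp.supported_mono (simplicesIn_faceSet_subset hs n)
    (tupleToSingular_mem_supported (Finsupp.single_mem_supported k (1 : k) hw))

/-- The simplicial chain of the approximation of an iterated subdivision of a singular chain. -/
def subdivisionApproximation (k : Type*) [Field k] (V : Type u) [Fintype V] [LinearOrder V]
    [Nonempty V] (N n : ℕ) : SingularChain k (V → ℝ) n →ₗ[k] (Finset V →₀ k) :=
  tupleToFinset k V n ∘ₗ singularToTuple k V n ∘ₗ singularSubdivision k (V → ℝ) n ^ N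

theorem finsetBoundary_subdivisionApproximation [Nonempty V] (N : ℕ) {n : ℕ}
    (z : SingularChain k (V → ℝ) (n + 1)) :
    finsetBoundary k V (subdivisionApproximation k V N (n + 1) z) =
      subdivisionApproximation k V N n (singularBoundary k (V → ℝ) n z) := by
  simp only [subdivisionApproximation, LinearMap.comp_apply, finsetBoundary_tupleToFinset,
    tupleBoundary_singularToTuple, singularBoundary_singularSubdivision_pow]

/-- All maps in the composite preserve closed faces and the augmentation, so the carrier criterion
applies without any condition on `N`. -/
theorem subdivisionApproximation_simplicialToSingular_single [Nonempty V] (N : ℕ) {n : ℕ}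
    {s : Finset V} (hs : s.card = n) :
    subdivisionApproximation k V N n (simplicialToSingular k V n (Finsupp.single s 1)) =
      Finsupp.single s 1 := by
  refine eq_single_of_carried (f := fun n =>
    subdivisionApproximation k V N n ∘ₗ simplicialToSingular k V n) ?_ (fun n z => ?_)
    (fun s => ?_) hs
  · simp only [subdivisionApproximation, simplicialToSingular, LinearMap.comp_apply]
    rw [sortedTuple_single Finset.card_empty, singularSubdivision_zero, tupleToSingular,
      Finsupp.lmapDomain_apply, Finsupp.mapDomain_single, ← Module.End.one_eq_id, one_pow,
      Module.End.one_apply, singularToTuple, Finsupp.lmapDomain_apply, Finsupp.mapDomain_single,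
      tupleToFinset_zero_single]
  · simp only [LinearMap.comp_apply, finsetBoundary_subdivisionApproximation,
      singularBoundary_simplicialToSingular]
  · exact tupleToFinset_mem_supported (singularToTuple_mem_supported
      (singularSubdivision_pow_mem_supported N (simplicialToSingular_single_mem s _)))

theorem subdivisionApproximation_simplicialToSingular [Nonempty V] (N : ℕ)
    {A : PreAbstractSimplicialComplex V} {d : ℕ} {z : Finset V →₀ k} (hz : z ∈ chains k A d) :
    subdivisionApproximation k V N (d + 1) (simplicialToSingular k V (d + 1) z) = z := by
  suffices H : (subdivisionApproximation k V N (d + 1) ∘ₗ simplicialToSingular k V (d + 1) -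
      LinearMap.id : (Finset V →₀ k) →ₗ[k] (Finset V →₀ k)) z ∈
        (⊥ : Submodule k (Finset V →₀ k)) by
    rw [Submodule.mem_bot] at H
    exact sub_eq_zero.1 H
  refine map_mem_of_supported _ (fun s hs => ?_) hz
  rw [Submodule.mem_bot, LinearMap.sub_apply, sub_eq_zero]
  exact subdivisionApproximation_simplicialToSingular_single N hs.2

/-- A simplicial chain that bounds in the singular chains of the underlying space is a simplicial
boundary. -/
theorem mem_boundaries_of_singularBoundary_eq {A : PreAbstractSimplicialComplex V} {d : ℕ}
    {z : Finset V →₀ k} (hz : z ∈ chains k A d) {y : SingularChain k (V → ℝ) (d + 2)}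
    (hy : y ∈ chainsIn k A (d + 2))
    (h : singularBoundary k (V → ℝ) (d + 1) y = simplicialToSingular k V (d + 1) z) :
    z ∈ boundaries k A d := by
  rcases isEmpty_or_nonempty V with hV | hV
  · rw [eq_zero_of_mem_chains hz]
    exact Submodule.zero_mem _
  -- `N` depends on the filling `y`. The approximation of `y` is then a simplicial chain of `A` with
  -- boundary `z`, because the approximation map fixes `z`.
  · obtain ⟨N, hN⟩ := exists_singularSubdivision_pow_mem hy
    have hc : subdivisionApproximation k V N (d + 2) y ∈ chains k A (d + 1) :=
      tupleToFinset_mem_chains (singularToTuple_mem_supported_tuplesIn hN)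
    refine ⟨_, hc, ?_⟩
    rw [boundaryMap_eq_of_mem_chains hc, finsetBoundary_subdivisionApproximation, h,
      subdivisionApproximation_simplicialToSingular N hz]

theorem singularBoundary_simplicialToSingular_of_mem_chains {A : PreAbstractSimplicialComplex V}
    {d : ℕ} {z : Finset V →₀ k} (hz : z ∈ chains k A (d + 1)) :
    singularBoundary k (V → ℝ) (d + 1) (simplicialToSingular k V (d + 2) z) =
      simplicialToSingular k V (d + 1) (boundaryMap k z) := by
  rw [singularBoundary_simplicialToSingular, boundaryMap_eq_of_mem_chains hz]

/-- The prism over the boundary vanishes for a cycle. For `n = 0` it vanishes anyway, as the prism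
is zero on the augmentation; this is why unreduced `0`-chains need no cycle condition. -/
theorem SimplexHomotopy.sub_mem_map_singularBoundary {X : Type*} [TopologicalSpace X]
    (h : SimplexHomotopy X) {n : ℕ} {s : Set C(stdSimplex ℝ (Fin (n + 1)), X)} {Z : Set X}
    (hs : ∀ σ ∈ s, ∀ p, h.toMap σ p ∈ Z) {z : SingularChain k X (n + 1)}
    (hz : z ∈ Finsupp.supported k k s) (hcyc : n = 0 ∨ singularBoundary k X n z = 0) :
    z - singularSubdivision k X (n + 1) (Finsupp.lmapDomain k k h.target z) ∈
      (Finsupp.supported k k (simplicesIn (n + 2) Z)).map (singularBoundary k X (n + 1)) := by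
  refine ⟨_, h.prism_mem_supported hs hz, ?_⟩
  rw [h.singularBoundary_prism, sub_eq_self]
  rcases hcyc with rfl | hcyc
  · rw [h.prism_zero, LinearMap.zero_apply]
  · rw [hcyc, LinearMap.map_zero]

theorem sub_singularSubdivision_pow_mem {X : Type*} [TopologicalSpace X] (N : ℕ)
    {n : ℕ} {Z : Set X} {z : SingularChain k X (n + 1)}
    (hz : z ∈ Finsupp.supported k k (simplicesIn (n + 1) Z))
    (hcyc : n = 0 ∨ singularBoundary k X n z = 0) :
    z - (singularSubdivision k X (n + 1) ^ N) z ∈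
      (Finsupp.supported k k (simplicesIn (n + 2) Z)).map (singularBoundary k X (n + 1)) := by
  induction N with
  | zero => simp
  | succ N ih =>
    have h := (SimplexHomotopy.refl X).sub_mem_map_singularBoundary (Z := Z)
      (s := simplicesIn (n + 1) Z) (fun σ hσ p => hσ p.1) (singularSubdivision_pow_mem_supported N hz)
      (hcyc.imp_right fun h => by rw [singularBoundary_singularSubdivision_pow, h, map_zero])
    have hid : ∀ y : SingularChain k X (n + 1),
        Finsupp.lmapDomain k k (SimplexHomotopy.refl X).target y = y := fun y =>
      Finsupp.mapDomain_id
    rw [hid] at h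
    have h' := Submodule.add_mem _ ih h
    rwa [sub_add_sub_cancel, ← Module.End.mul_apply, ← pow_succ'] at h'

/-- Every singular cycle of the underlying space is homologous to a simplicial cycle. -/
theorem exists_mem_cycles_sub_mem {A : PreAbstractSimplicialComplex V} {d : ℕ}
    {z : SingularChain k (V → ℝ) (d + 1)} (hz : z ∈ chainsIn k A (d + 1))
    (hcyc : d = 0 ∨ singularBoundary k (V → ℝ) d z = 0) :
    ∃ y ∈ cycles k A d, z - simplicialToSingular k V (d + 1) y ∈
      (chainsIn k A (d + 2)).map (singularBoundary k (V → ℝ) (d + 1)) := by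
  rcases isEmpty_or_nonempty V with hV | hV
  · refine ⟨0, Submodule.zero_mem _, ?_⟩
    have h0 : z = 0 := by
      rw [← Submodule.mem_bot k]
      refine map_mem_of_supported LinearMap.id (fun σ hσ => ?_) hz
      -- Without vertices no point exists: its barycentric coordinates would sum to `0` instead of
      -- `1`.
      obtain ⟨s, -, hx⟩ := mem_realizationSet.1 (hσ (stdSimplex.vertex 0))
      have := hx.1.2
      simp at this
    rw [h0, map_zero, sub_zero]
    exact Submodule.zero_mem _
  · obtain ⟨N, hN⟩ := exists_singularSubdivision_pow_mem hz
    set z₁ := (singularSubdivision k (V → ℝ) (d + 1) ^ N) z with hz₁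
    have hcyc₁ : d = 0 ∨ singularBoundary k (V → ℝ) d z₁ = 0 :=
      hcyc.imp_right fun h => by rw [hz₁, singularBoundary_singularSubdivision_pow, h, map_zero]
    set w := singularToTuple k V (d + 1) z₁ with hw
    have hwA : w ∈ Finsupp.supported k k (tuplesIn A (d + 1)) :=
      singularToTuple_mem_supported_tuplesIn hN
    have hwcyc : d = 0 ∨ tupleBoundary k V d w = 0 :=
      hcyc₁.imp_right fun h => by rw [hw, tupleBoundary_singularToTuple, h, map_zero]
    have hy : tupleToFinset k V (d + 1) w ∈ chains k A d := tupleToFinset_mem_chains hwA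
    refine ⟨tupleToFinset k V (d + 1) w, ⟨hy, ?_⟩, ?_⟩
    · rw [SetLike.mem_coe, LinearMap.mem_ker]
      rcases d with _ | d
      · rw [← Submodule.mem_bot k]
        refine map_mem_of_supported _ (fun s hs => ?_) hy
        have := hs.2
        simp [boundaryMap, this]
      · rw [boundaryMap_eq_of_mem_chains hy, finsetBoundary_tupleToFinset,
          hwcyc.resolve_left (Nat.succ_ne_zero d), map_zero]
    -- The homologies go from `z` to `z₁`, to the subdivided approximation, to the approximation
    -- itself, and to its sorted form. The third is needed because the prism ends in a subdivision;
    -- it enters the telescoping sum with a minus sign.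
    · have h₁ := sub_singularSubdivision_pow_mem N hz hcyc
      have h₂ := (approximationHomotopy V).sub_mem_map_singularBoundary
        (fun σ hσ p => approximationHomotopy_mem_realizationSet hσ p) hN hcyc₁
      rw [lmapDomain_approximationHomotopy_target, ← hw] at h₂
      have h₃ := sub_singularSubdivision_pow_mem 1 (tupleToSingular_mem_chainsIn hwA)
        (hwcyc.imp_right fun h => by rw [singularBoundary_tupleToSingular, h, map_zero])
      rw [pow_one] at h₃
      have h₄ : tupleToSingular k V (d + 1) w -
          simplicialToSingular k V (d + 1) (tupleToFinset k V (d + 1) w) ∈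
            (chainsIn k A (d + 2)).map (singularBoundary k (V → ℝ) (d + 1)) := by
        refine ⟨_, tupleToSingular_mem_chainsIn (sortHomotopy_mem_supported_tuplesIn hwA), ?_⟩
        have h0 : sortHomotopy k V d (tupleBoundary k V d w) = 0 := by
          rcases hwcyc with rfl | h
          · rw [sortHomotopy_zero, LinearMap.zero_apply]
          · rw [h, map_zero]
        rw [singularBoundary_tupleToSingular, tupleBoundary_sortHomotopy, h0, sub_zero, map_sub]
        rfl
      have h := Submodule.add_mem _ (Submodule.sub_mem _ (Submodule.add_mem _ h₁ h₂) h₃) h₄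
      rw [← hz₁] at h
      convert h using 1
      abel

end Comparison

end PersistenceDiagram

end

/-! ### Transfer to singular homology of the underlying space. -/

noncomputable section

namespace PersistenceDiagram

/-! ### Homology classes in complexes of modules -/

section Homology

open HomologicalComplex

variable {R : Type*} [Ring R] (K : ChainComplex (ModuleCat.{u} R) ℕ)

theorem exists_eq_homologyπ {d : ℕ} (h : K.homology d) : ∃ c : K.cycles d, K.homologyπ d c = h :=
  (ModuleCat.epi_iff_surjective (K.homologyπ d)).1 inferInstance h

theorem iCycles_injective (d : ℕ) : Function.Injective (K.iCycles d) :=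
  (ModuleCat.mono_iff_injective (K.iCycles d)).1 inferInstance

theorem d_iCycles_apply {d j : ℕ} (c : K.cycles d) : K.d d j (K.iCycles d c) = 0 := by
  rw [← ModuleCat.comp_apply, K.iCycles_d]
  rfl

/-- The image of a cycle in the opcycles factors through its homology class, so it is zero there,
and the kernel of the projection to opcycles is the image of the differential. -/
theorem exists_d_eq_of_homologyπ_eq_zero {d : ℕ} {c : K.cycles d} (h : K.homologyπ d c = 0) :
    ∃ w : K.X (d + 1), K.d (d + 1) d w = K.iCycles d c := by
  have hp : (K.sc d).pOpcycles (K.iCycles d c) = 0 := by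
    have h' : K.pOpcycles d (K.iCycles d c) = K.homologyι d (K.homologyπ d c) := by
      rw [← ModuleCat.comp_apply, ← ModuleCat.comp_apply, K.homology_π_ι]
    rw [h, map_zero] at h'
    exact h'
  obtain ⟨w, hw⟩ := (ShortComplex.moduleCat_pOpcycles_eq_zero_iff _ _).1 hp
  -- The predecessor of `d` equals `d + 1` only propositionally; a variable index permits the
  -- substitution.
  have key : ∀ j, (ComplexShape.down ℕ).prev d = j →
      ∃ w : K.X j, K.d j d w = K.iCycles d c := by
    rintro j rfl
    exact ⟨w, hw⟩
  exact key _ (ChainComplex.prev ℕ d)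

theorem homologyπ_eq_of_sub_eq_d {d : ℕ} {c c' : K.cycles d} {w : K.X (d + 1)}
    (h : K.iCycles d c - K.iCycles d c' = K.d (d + 1) d w) :
    K.homologyπ d c = K.homologyπ d c' := by
  have hc : c - c' = K.toCycles (d + 1) d w := by
    apply iCycles_injective
    rw [map_sub, h, ← ModuleCat.comp_apply, K.toCycles_i]
  rw [← sub_eq_zero, ← map_sub, hc, ← ModuleCat.comp_apply, K.toCycles_comp_homologyπ]
  rfl

end Homology

/-! ### Chains of simplicial sets as finitely supported functions -/

section Chains

open Simplicial

variable (k : Type u) [Field k]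

/-- The chains of a simplicial set with coefficients in a field are the finitely supported
functions on simplices. -/
def chainEquiv (S : SSet.{u}) (n : ℕ) :
    (S.chainComplex (ModuleCat.of k k)).X n ≃ₗ[k] (S _⦋n⦌ →₀ k) := by
  let f : (S.chainComplex (ModuleCat.of k k)).X n ⟶ ModuleCat.of k (S _⦋n⦌ →₀ k) :=
    (S.isColimitChainComplexXCofan (ModuleCat.of k k) n).desc
      (Limits.Cofan.mk _ fun x => ModuleCat.ofHom (Finsupp.lsingle x))
  have hf : ∀ x, S.ιChainComplex x ≫ f = ModuleCat.ofHom (Finsupp.lsingle x) := fun x =>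
    (S.isColimitChainComplexXCofan (ModuleCat.of k k) n).fac _ ⟨x⟩
  let g : (S _⦋n⦌ →₀ k) →ₗ[k] (S.chainComplex (ModuleCat.of k k)).X n :=
    Finsupp.linearCombination k fun x => (S.ιChainComplex (R := ModuleCat.of k k) x).hom (1 : k)
  refine LinearEquiv.ofLinearMap f.hom g ?_ ?_
  · apply Finsupp.lhom_ext'
    intro x
    ext1
    have := DFunLike.congr_fun (congrArg ModuleCat.Hom.hom (hf x)) (1 : k)
    simpa [g] using this
  · have : f ≫ ModuleCat.ofHom g = 𝟙 _ := by
      apply SSet.chainComplex_hom_ext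
      intro x
      rw [← Category.assoc, hf x, Category.comp_id]
      ext
      simp [g]
    exact congrArg ModuleCat.Hom.hom this

theorem chainEquiv_ι (S : SSet.{u}) {n : ℕ} (x : S _⦋n⦌) :
    chainEquiv k S n ((S.ιChainComplex (R := ModuleCat.of k k) x).hom (1 : k)) =
      Finsupp.single x 1 := by
  have : (chainEquiv k S n).symm (Finsupp.single x 1) =
      (S.ιChainComplex (R := ModuleCat.of k k) x).hom (1 : k) := by
    simp [chainEquiv]
  rw [← this, LinearEquiv.apply_symm_apply]

theorem chain_hom_ext {S : SSet.{u}} {n : ℕ} {M : Type*} [AddCommGroup M] [Module k M]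
    {f g : (S.chainComplex (ModuleCat.of k k)).X n →ₗ[k] M}
    (h : ∀ x, f ((S.ιChainComplex (R := ModuleCat.of k k) x).hom (1 : k)) =
      g ((S.ιChainComplex (R := ModuleCat.of k k) x).hom (1 : k))) : f = g := by
  suffices H : f ∘ₗ (chainEquiv k S n).symm.toLinearMap = g ∘ₗ (chainEquiv k S n).symm.toLinearMap by
    ext z
    have := LinearMap.congr_fun H (chainEquiv k S n z)
    simpa using this
  apply Finsupp.lhom_ext'
  intro x
  ext1
  have := h x
  simp only [LinearMap.comp_apply, Finsupp.lsingle_apply, LinearEquiv.coe_coe]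
  rwa [← chainEquiv_ι, LinearEquiv.symm_apply_apply]

end Chains

/-! ### Singular homology of the underlying space -/

section Comparison

open Simplicial HomologicalComplex

variable (k : Type u) [Field k] {V : Type u} [Fintype V]

/-- The singular chain complex of the underlying space of `A`. -/
abbrev singularComplex (A : PreAbstractSimplicialComplex V) : ChainComplex (ModuleCat.{u} k) ℕ :=
  (TopCat.toSSet.obj ((realization V).obj A)).chainComplex (ModuleCat.of k k)

/-- The singular simplex of `V → ℝ` given by a singular simplex of the underlying space. -/
def ambientSimplex (A : PreAbstractSimplicialComplex V) {n : ℕ}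
    (x : (TopCat.toSSet.obj ((realization V).obj A)) _⦋n⦌) :
    C(stdSimplex ℝ (Fin (n + 1)), V → ℝ) :=
  (⟨Subtype.val, continuous_subtype_val⟩ : C(realizationSet A, V → ℝ)).comp
    (TopCat.toSSetObjEquiv _ _ x)

theorem ambientSimplex_injective (A : PreAbstractSimplicialComplex V) (n : ℕ) :
    Function.Injective (ambientSimplex A (n := n)) := by
  intro x y h
  apply (TopCat.toSSetObjEquiv _ _).injective
  ext1 t
  exact Subtype.ext (DFunLike.congr_fun h t)

theorem range_ambientSimplex (A : PreAbstractSimplicialComplex V) (n : ℕ) :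
    Set.range (ambientSimplex A (n := n)) = simplicesIn (n + 1) (realizationSet A) := by
  ext σ
  constructor
  · rintro ⟨x, rfl⟩ t
    exact (TopCat.toSSetObjEquiv _ _ x t).2
  · intro hσ
    refine ⟨(TopCat.toSSetObjEquiv ((realization V).obj A) (.op ⦋n⦌)).symm
      ⟨fun t => ⟨σ t, hσ t⟩, σ.continuous.subtype_mk _⟩, ?_⟩
    rw [ambientSimplex, Equiv.apply_symm_apply]
    rfl

theorem ambientSimplex_δ (A : PreAbstractSimplicialComplex V) {n : ℕ}
    (x : (TopCat.toSSet.obj ((realization V).obj A)) _⦋n + 1⦌) (i : Fin (n + 2)) :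
    ambientSimplex A ((TopCat.toSSet.obj ((realization V).obj A)).δ i x) =
      (ambientSimplex A x).comp (coface i) := by
  ext1 t
  exact congrArg Subtype.val (TopCat.toSSetObjEquiv_δ_apply x i t)

theorem ambientSimplex_map {A B : PreAbstractSimplicialComplex V} (f : A ⟶ B) {n : ℕ}
    (x : (TopCat.toSSet.obj ((realization V).obj A)) _⦋n⦌) :
    ambientSimplex B ((TopCat.toSSet.map ((realization V).map f)).app _ x) =
      ambientSimplex A x := rfl

/-- The chains of the underlying space of `A` as singular chains of `V → ℝ`. -/
def ambientChain (A : PreAbstractSimplicialComplex V) (n : ℕ) :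
    (singularComplex k A).X n →ₗ[k] SingularChain k (V → ℝ) (n + 1) :=
  Finsupp.lmapDomain k k (ambientSimplex A) ∘ₗ (chainEquiv k _ n).toLinearMap

theorem ambientChain_ι (A : PreAbstractSimplicialComplex V) {n : ℕ}
    (x : (TopCat.toSSet.obj ((realization V).obj A)) _⦋n⦌) :
    ambientChain k A n ((SSet.ιChainComplex (R := ModuleCat.of k k) _ x).hom (1 : k)) =
      Finsupp.single (ambientSimplex A x) 1 := by
  rw [ambientChain, LinearMap.comp_apply, LinearEquiv.coe_coe, chainEquiv_ι,
    Finsupp.lmapDomain_apply, Finsupp.mapDomain_single]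

theorem ambientChain_injective (A : PreAbstractSimplicialComplex V) (n : ℕ) :
    Function.Injective (ambientChain k A n) :=
  (Finsupp.mapDomain_injective (ambientSimplex_injective A n)).comp (chainEquiv k _ n).injective

theorem range_ambientChain (A : PreAbstractSimplicialComplex V) (n : ℕ) :
    LinearMap.range (ambientChain k A n) = chainsIn k A (n + 1) := by
  rw [ambientChain, LinearMap.range_comp_of_range_eq_top _ (LinearEquiv.range _),
    Finsupp.range_lmapDomain, chainsIn, ← range_ambientSimplex, Finsupp.supported_eq_span_single,
    ← Set.range_comp]
  rfl

theorem ambientChain_d (A : PreAbstractSimplicialComplex V) (n : ℕ)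
    (z : (singularComplex k A).X (n + 1)) :
    ambientChain k A n ((singularComplex k A).d (n + 1) n z) =
      singularBoundary k (V → ℝ) (n + 1) (ambientChain k A (n + 1) z) := by
  suffices H : ambientChain k A n ∘ₗ ((singularComplex k A).d (n + 1) n).hom =
      singularBoundary k (V → ℝ) (n + 1) ∘ₗ ambientChain k A (n + 1) from LinearMap.congr_fun H z
  apply chain_hom_ext
  intro x
  have h := DFunLike.congr_fun (congrArg ModuleCat.Hom.hom
    (SSet.ιChainComplex_d (TopCat.toSSet.obj ((realization V).obj A)) (ModuleCat.of k k) x)) (1 : k)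
  rw [ModuleCat.hom_comp, LinearMap.comp_apply] at h
  rw [LinearMap.comp_apply, LinearMap.comp_apply, h, ambientChain_ι, singularBoundary,
    alternatingSum_single, ModuleCat.hom_sum, LinearMap.sum_apply, map_sum]
  refine Finset.sum_congr rfl fun i _ => ?_
  rw [← ambientSimplex_δ, ← ambientChain_ι, ← map_smul]
  congr 1
  -- One sign multiplies a morphism, the other is a scalar of `k`; parity reduces both to `±1`.
  rcases Nat.even_or_odd (i : ℕ) with hi | hi <;> simp [hi.neg_one_pow]

theorem ambientChain_map {A B : PreAbstractSimplicialComplex V} (f : A ⟶ B) (n : ℕ)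
    (z : (singularComplex k A).X n) :
    ambientChain k B n ((SSet.chainComplexMap (TopCat.toSSet.map ((realization V).map f))
      (ModuleCat.of k k)).f n z) = ambientChain k A n z := by
  suffices H : ambientChain k B n ∘ₗ ((SSet.chainComplexMap
      (TopCat.toSSet.map ((realization V).map f)) (ModuleCat.of k k)).f n).hom =
        ambientChain k A n from LinearMap.congr_fun H z
  apply chain_hom_ext
  intro x
  have h := DFunLike.congr_fun (congrArg ModuleCat.Hom.hom
    (SSet.ι_chainComplexMap_f _ _ (TopCat.toSSet.map ((realization V).map f)) (ModuleCat.of k k) x))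
    (1 : k)
  rw [ModuleCat.hom_comp, LinearMap.comp_apply] at h
  rw [LinearMap.comp_apply, h, ambientChain_ι, ambientChain_ι, ambientSimplex_map]

/-- The chains of the underlying space are the singular chains with values in it. -/
def chainsInEquiv (A : PreAbstractSimplicialComplex V) (n : ℕ) :
    (singularComplex k A).X n ≃ₗ[k] chainsIn k A (n + 1) :=
  (LinearEquiv.ofInjective _ (ambientChain_injective k A n)).trans
    (LinearEquiv.ofEq _ _ (range_ambientChain k A n))

theorem chainsInEquiv_coe (A : PreAbstractSimplicialComplex V) {n : ℕ}
    (z : (singularComplex k A).X n) : (chainsInEquiv k A n z : _) = ambientChain k A n z := rfl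

variable [LinearOrder V]

/-- The singular chain in the underlying space of a simplicial cycle. -/
def cycleToSingular (A : PreAbstractSimplicialComplex V) (d : ℕ) :
    cycles k A d →ₗ[k] (singularComplex k A).X d :=
  (chainsInEquiv k A d).symm.toLinearMap ∘ₗ
    LinearMap.codRestrict _ (simplicialToSingular k V (d + 1) ∘ₗ (cycles k A d).subtype)
      fun z => simplicialToSingular_mem_chainsIn z.2.1 _

theorem ambientChain_cycleToSingular {A : PreAbstractSimplicialComplex V} {d : ℕ}
    (z : cycles k A d) :
    ambientChain k A d (cycleToSingular k A d z) = simplicialToSingular k V (d + 1) z := by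
  rw [← chainsInEquiv_coe, cycleToSingular, LinearMap.comp_apply, LinearEquiv.coe_coe,
    LinearEquiv.apply_symm_apply]
  rfl

/-- The singular chain of a simplicial cycle, as a morphism. -/
def cycleHom (A : PreAbstractSimplicialComplex V) (d : ℕ) :
    ModuleCat.of k (cycles k A d) ⟶ (singularComplex k A).X d :=
  ModuleCat.ofHom (X := cycles k A d) (Y := (singularComplex k A).X d) (cycleToSingular k A d)

theorem cycleHom_d (A : PreAbstractSimplicialComplex V) (d : ℕ) :
    cycleHom k A d ≫ (singularComplex k A).d d ((ComplexShape.down ℕ).next d) = 0 := by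
  rcases d with _ | d
  -- In degree `0` the outgoing differential is zero, since the complex is not augmented.
  · rw [(singularComplex k A).shape, Limits.comp_zero]
    simp
  · rw [ChainComplex.next_nat_succ]
    ext z
    apply ambientChain_injective k A d
    change ambientChain k A d ((singularComplex k A).d (d + 1) d (cycleToSingular k A _ z)) =
      ambientChain k A d 0
    rw [ambientChain_d, ambientChain_cycleToSingular,
      singularBoundary_simplicialToSingular_of_mem_chains z.2.1, LinearMap.mem_ker.1 z.2.2,
      map_zero, map_zero]

/-- The singular homology class of a simplicial cycle. -/
def cycleClass (A : PreAbstractSimplicialComplex V) (d : ℕ) :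
    cycles k A d →ₗ[k] (singularComplex k A).homology d :=
  ((singularComplex k A).liftCycles (cycleHom k A d) _ rfl
    (cycleHom_d k A d) ≫ (singularComplex k A).homologyπ d).hom

/-- The singular cycle of a simplicial cycle. -/
def singularCycle (A : PreAbstractSimplicialComplex V) {d : ℕ} (z : cycles k A d) :
    (singularComplex k A).cycles d :=
  (singularComplex k A).liftCycles (cycleHom k A d) _ rfl (cycleHom_d k A d) z

theorem cycleClass_apply (A : PreAbstractSimplicialComplex V) {d : ℕ} (z : cycles k A d) :
    cycleClass k A d z = (singularComplex k A).homologyπ d (singularCycle k A z) := rfl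

theorem iCycles_singularCycle {A : PreAbstractSimplicialComplex V} {d : ℕ} (z : cycles k A d) :
    (singularComplex k A).iCycles d (singularCycle k A z) = cycleToSingular k A d z := by
  rw [singularCycle, ← ModuleCat.comp_apply, liftCycles_i]
  rfl

theorem cycleClass_surjective (A : PreAbstractSimplicialComplex V) (d : ℕ) :
    Function.Surjective (cycleClass k A d) := by
  intro h
  obtain ⟨c, rfl⟩ := exists_eq_homologyπ _ h
  set x := (singularComplex k A).iCycles d c with hx
  have hxA : ambientChain k A d x ∈ chainsIn k A (d + 1) := (chainsInEquiv k A d x).2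
  obtain ⟨y, hy, w, hw, hwy⟩ := exists_mem_cycles_sub_mem hxA (by
    rcases d with _ | d
    · exact Or.inl rfl
    · refine Or.inr ?_
      rw [← ambientChain_d, hx, d_iCycles_apply, map_zero])
  refine ⟨⟨y, hy⟩, ?_⟩
  rw [cycleClass_apply]
  obtain ⟨w, rfl⟩ := (range_ambientChain k A (d + 1)).ge hw
  refine (homologyπ_eq_of_sub_eq_d _ (w := w) ?_).symm
  apply ambientChain_injective k A d
  rw [iCycles_singularCycle, map_sub, ambientChain_cycleToSingular, ambientChain_d,
    hwy, hx]

theorem cycleClass_eq_zero_iff {A : PreAbstractSimplicialComplex V} {d : ℕ} (z : cycles k A d) :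
    cycleClass k A d z = 0 ↔ (z : Finset V →₀ k) ∈ boundaries k A d := by
  rw [cycleClass_apply]
  constructor
  · intro h
    obtain ⟨w, hw⟩ := exists_d_eq_of_homologyπ_eq_zero _ h
    refine mem_boundaries_of_singularBoundary_eq z.2.1 (chainsInEquiv k A (d + 1) w).2 ?_
    rw [chainsInEquiv_coe, ← ambientChain_d, hw, iCycles_singularCycle,
      ambientChain_cycleToSingular]
  · rintro ⟨y, hy, hyz⟩
    obtain ⟨w, hw⟩ := (range_ambientChain k A (d + 1)).ge
      (simplicialToSingular_mem_chainsIn hy (d + 2))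
    refine (homologyπ_eq_of_sub_eq_d _ (c' := 0) (w := w) ?_).trans (map_zero _)
    apply ambientChain_injective k A d
    rw [iCycles_singularCycle, map_zero, sub_zero, ambientChain_cycleToSingular,
      ambientChain_d, hw, singularBoundary_simplicialToSingular_of_mem_chains hy, hyz]

/-- Both sides are represented by the same chain of `V → ℝ`, so naturality already holds on cycles
and the witness for the boundary is `0`. -/
theorem homologyMap_cycleClass {A B : PreAbstractSimplicialComplex V} (f : A ⟶ B) {d : ℕ}
    (z : cycles k A d) :
    HomologicalComplex.homologyMap (SSet.chainComplexMap
      (TopCat.toSSet.map ((realization V).map f)) (ModuleCat.of k k)) d (cycleClass k A d z) =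
        cycleClass k B d (Submodule.inclusion (cycles_mono k (leOfHom f) d) z) := by
  rw [cycleClass_apply, cycleClass_apply, ← ModuleCat.comp_apply, homologyπ_naturality,
    ModuleCat.comp_apply]
  refine homologyπ_eq_of_sub_eq_d _ (w := 0) ?_
  rw [map_zero, sub_eq_zero, iCycles_singularCycle, ← ModuleCat.comp_apply, cyclesMap_i,
    ModuleCat.comp_apply, iCycles_singularCycle]
  apply ambientChain_injective k B d
  rw [ambientChain_map, ambientChain_cycleToSingular, ambientChain_cycleToSingular]
  rfl

end Comparison

end PersistenceDiagram

end

/-! ### Möbius inversion and rank formulas. -/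

noncomputable section

namespace PersistenceDiagram

/-! ### Möbius inversion of functions that differ by a function of the birth index -/

theorem moebius_spec {Q : Type*} [PartialOrder Q] [Finite Q] (m : Q → ℤ) (b : Q) :
    m b = ∑ᶠ a ∈ Set.Iic b, moebius m a :=
  (existsUnique_moebius m).choose_spec.1 b

theorem eq_moebius {Q : Type*} [PartialOrder Q] [Finite Q] {m n : Q → ℤ}
    (h : ∀ b, m b = ∑ᶠ a ∈ Set.Iic b, n a) : n = moebius m :=
  (existsUnique_moebius m).choose_spec.2 n h

open Classical in
-- A diagonal interval `[x, x]` lies below `[a, b]` exactly when `x ≤ a`, as `x ≤ b` then follows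
-- from `a ≤ b`.
theorem finsum_diagonal {P : Type*} [PartialOrder P] (c : P → ℤ) (I : Intervals P) :
    ∑ᶠ J ∈ Set.Iic I, (if J.1.1 = J.1.2 then c J.1.1 else 0) = ∑ᶠ a ∈ Set.Iic I.1.1, c a := by
  let diag : P → Intervals P := fun a => ⟨(a, a), le_rfl⟩
  have hdiag : Set.InjOn diag (Set.Iic I.1.1) := fun a _ b _ h => congrArg (fun J => J.1.1) h
  rw [finsum_mem_inter_support_eq (t := diag '' Set.Iic I.1.1), finsum_mem_image hdiag]
  · exact finsum_mem_congr rfl fun a _ => if_pos rfl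
  · ext J
    simp only [Set.mem_inter_iff, Function.mem_support, ne_eq, ite_eq_right_iff,
      Classical.not_imp]
    refine and_congr_left fun ⟨hJ, _⟩ => ⟨fun h => ⟨J.1.1, h.1, ?_⟩, ?_⟩
    · exact Subtype.ext (Prod.ext rfl hJ)
    · rintro ⟨a, ha, rfl⟩
      exact ⟨ha, le_trans ha I.2⟩

/-- Adding `∂c` on the diagonal to `∂n` gives a function with the sums of `m`; by uniqueness it is
`∂m`, and off the diagonal nothing was added. -/
theorem equivalent_moebius_of_eq_add {P : Type*} [PartialOrder P] [Finite P]
    {m n : Intervals P → ℤ} (c : P → ℤ) (h : ∀ I, m I = n I + c I.1.1) :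
    Equivalent (moebius m) (moebius n) := by
  classical
  intro I hI
  have key : (fun J : Intervals P =>
      moebius n J + if J.1.1 = J.1.2 then moebius c J.1.1 else 0) = moebius m := by
    apply eq_moebius
    intro J
    rw [finsum_mem_add_distrib (Set.toFinite _), finsum_diagonal, ← moebius_spec, ← moebius_spec, h]
  rw [← congrFun key I]
  simp [hI.ne]

/-! ### Birth-death functions and ranks -/

/-- Rank-nullity for `g ∘ f`, whose range is that of `g` because `f` is onto. Both birth-death
functions are kernels of this shape with the same `g`. -/
theorem finrank_ker_comp_eq {k : Type*} [Field k] {U W X : Type*} [AddCommGroup U] [Module k U]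
    [AddCommGroup W] [Module k W] [AddCommGroup X] [Module k X] [FiniteDimensional k U]
    {f : U →ₗ[k] W} (hf : Function.Surjective f) (g : W →ₗ[k] X) :
    (Module.finrank k (LinearMap.ker (g ∘ₗ f)) : ℤ) =
      Module.finrank k U - Module.finrank k (LinearMap.range g) := by
  have h := LinearMap.finrank_range_add_finrank_ker (g ∘ₗ f)
  rw [LinearMap.range_comp_of_range_eq_top _ (LinearMap.range_eq_top.2 hf)] at h
  omega

theorem finrank_inf_eq {k : Type*} [Field k] {U W X : Type*} [AddCommGroup U] [Module k U]
    [AddCommGroup W] [Module k W] [AddCommGroup X] [Module k X] [FiniteDimensional k U]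
    {Z B : Submodule k U} {f : Z →ₗ[k] W} (hf : Function.Surjective f) (g : W →ₗ[k] X)
    (h : ∀ z, g (f z) = 0 ↔ (z : U) ∈ B) :
    (Module.finrank k (Z ⊓ B : Submodule k U) : ℤ) =
      Module.finrank k Z - Module.finrank k (LinearMap.range g) := by
  have hker : LinearMap.ker (g ∘ₗ f) = B.comap Z.subtype := by
    ext z
    exact h z
  rw [← finrank_ker_comp_eq hf, hker, ← Submodule.finrank_map_subtype_eq,
    Submodule.map_comap_subtype]

variable {k : Type u} [Field k] {P : Type v} [PartialOrder P]

theorem presentationBD_eq {E M : P ⥤ ModuleCat.{u} k} {φ : E ⟶ M} (hφ : IsPresentation φ)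
    (I : Intervals P) :
    presentationBD φ I = Module.finrank k (E.obj I.1.1) -
      Module.finrank k (LinearMap.range (M.map (homOfLE I.2)).hom) := by
  have := hφ.finiteDimensional I.1.1
  rw [← finrank_ker_comp_eq (hφ.surjective I.1.1) (f := (φ.app I.1.1).hom), ← ModuleCat.hom_comp,
    ← φ.naturality, ModuleCat.hom_comp, LinearMap.ker_comp]
  rfl

/-- Simplicial cycles surject onto singular homology, and a cycle dies at a later index exactly if
it is a simplicial boundary there. -/
theorem exists_surjective_homologyModule {V : Type u} [LinearOrder V] [Fintype V]
    {K : PreAbstractSimplicialComplex V} (F : Filtration P K) (d : ℕ) (a : P) :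
    ∃ f : cycles k (F a).1 d →ₗ[k] (homologyModule k F d).obj a, Function.Surjective f ∧
      ∀ (b : P) (h : a ≤ b) (z : cycles k (F a).1 d),
        ((homologyModule k F d).map (homOfLE h)).hom (f z) = 0 ↔
          (z : Finset V →₀ k) ∈ boundaries k (F b).1 d := by
  refine ⟨cycleClass k (F a).1 d, cycleClass_surjective k (F a).1 d, fun b h z => ?_⟩
  have hF : (F a).1 ≤ (F b).1 := F.monotone h
  -- The structure map unfolds to the homology map of the inclusion, which sends the class of `z` to
  -- the class of the same cycle in the larger complex.
  refine (Eq.congr_left (homologyMap_cycleClass k (homOfLE hF) z)).trans ?_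
  exact cycleClass_eq_zero_iff k _

theorem filtrationBD_eq {V : Type u} [LinearOrder V] [Fintype V]
    {K : PreAbstractSimplicialComplex V} (F : Filtration P K) (d : ℕ) (I : Intervals P) :
    filtrationBD k F d I = Module.finrank k (cycles k (F I.1.1).1 d) -
      Module.finrank k (LinearMap.range ((homologyModule k F d).map (homOfLE I.2)).hom) := by
  obtain ⟨f, hf, hker⟩ := exists_surjective_homologyModule (k := k) F d I.1.1
  exact finrank_inf_eq hf ((homologyModule k F d).map (homOfLE I.2)).hom (hker _ I.2)

end PersistenceDiagram

end

theorem proposition5p4 {k : Type u} [Field k] {V : Type u} [LinearOrder V] [Fintype V]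
    (K : PreAbstractSimplicialComplex V) {P : Type v} [PartialOrder P] [Finite P]
    (F : PersistenceDiagram.Filtration P K) (d : ℕ)
    {E : P ⥤ ModuleCat.{u} k} (φ : E ⟶ PersistenceDiagram.homologyModule k F d)
    (hφ : PersistenceDiagram.IsPresentation φ) :
    PersistenceDiagram.Equivalent
      (PersistenceDiagram.moebius (PersistenceDiagram.filtrationBD k F d))
      (PersistenceDiagram.moebius (PersistenceDiagram.presentationBD φ)) :=
  PersistenceDiagram.equivalent_moebius_of_eq_add
    (fun a => (Module.finrank k (PersistenceDiagram.cycles k (F a).1 d) : ℤ) -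
      Module.finrank k (E.obj a))
    fun I => by
      rw [PersistenceDiagram.filtrationBD_eq, PersistenceDiagram.presentationBD_eq hφ]
      ring
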